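/- All logarithms are to base $2$. For $n\ge 1$ let $H_n=\sum_{i=1}^n \frac1i$ and $$|\mu(n)\rangle=\frac{1}{\sqrt{H_n}}\sum_{i=1}^n\frac{1}{\sqrt i}\,|i\rangle_A|i\rangle_B ,\qquad \rho_A=\operatorname{Tr}_B|\mu(n)\rangle\langle\mu(n)| .$$ For a density matrix $\rho$ with eigenvalues $(r_j)$ (with multiplicity) and $0\le\delta<1$ let $$\Delta_\delta(\rho)=\log\min\Bigl\{|J|\,\max_{j\in J}r_j \;:\; \sum_{j\in J}r_j\ge 1-\delta\Bigr\},$$ the minimum being over sets $J$ of eigenvalue indices. Let $F(\sigma,\omega)=\bigl(\operatorname{Tr}\sqrt{\sigma^{1/2}\omega\sigma^{1/2}}\bigr)^2$ be the Uhlmann fidelity. A *quantum protocol* consists of finitely many rounds. In each round Alice or Bob applies an isometry (a unitary with ancillas) to her or his system and sends a $d_i$-dimensional subsystem to the other party; in the end both apply local isometries and trace out a subsystem. Its cost is $\sum_i\log d_i$ qubits. A *classical protocol* (LOCC) consists of finitely many rounds in each of which Alice or Bob performs a local quantum measurement and announces the outcome, one of $d$ values, at a cost of $\log d$ bits; later steps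 may depend on earlier messages; in the end both apply local isometries and trace out a subsystem; its cost is the largest total number of bits over all sequences of messages. A protocol creates $|\mu(n)\rangle$ from EPR pairs with fidelity $1-\epsilon$ if, for some $m\ge 0$, it takes $m$ EPR pairs $\frac1{\sqrt2}(|00\rangle+|11\rangle)$ shared by Alice and Bob to a state $\widetilde\rho_{AB}$ (averaged over the measurement outcomes) with $F(|\mu(n)\rangle\langle\mu(n)|,\widetilde\rho_{AB})\ge 1-\epsilon$. Then: 1. For all $n\ge 1$ and $0\le\delta<1$, $$\Delta_\delta(\rho_A)\ \ge\ (1-2\delta)\log n-4-\log\log(n+1).$$ 2. There is a constant $K$ such that for all $n\ge 3$ and $\epsilon\ge 0$, every quantum protocol that creates $|\mu(n)\rangle$ from any number of EPR pairs with fidelity $1-\epsilon$ has cost $$C\ \ge\ \Bigl(\tfrac12-\sqrt[8]{4\epsilon}\Bigr)\log n-K\log\log n .$$ 3. There is a constant $K$ such that for all $n\ge 3$ and $\epsilon\ge 0$, every classical protocol that creates $|\mu(n)\rangle$ from any number of EPR pairs with fidelity $1-\epsilon$ has cost $$C\ \ge\ \bigl(1-2\sqrt[8]{4\epsilon}\bigr)\log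 n-K\log\log n .$$ In particular $C\ge(1-o(1))\log n$ as $n\to\infty$ and $\epsilon\to 0$: for every $\eta>0$ there are $\epsilon_0>0$ and $N$ such that, for all $n\ge N$, every classical protocol that creates $|\mu(n)\rangle$ from any number of EPR pairs with fidelity $1-\epsilon_0$ has cost $C\ge(1-\eta)\log n$. 4. This is asymptotically matched: for every $n\ge 1$ there is a classical protocol of cost at most $\lceil\log n\rceil$ bits that creates $|\mu(n)\rangle$ with fidelity $1$ from $\lceil\log n\rceil$ EPR pairs. -/

import Mathlib

open scoped Matrix

noncomputable section

namespace EntanglementCost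

/-! Pure states of a bipartite system with basis `|i⟩|j⟩` are given by their matrix of
amplitudes `ψ i j`.  In this form `(U ⊗ V)|ψ⟩` is the matrix `U * ψ * Vᵀ`. -/

/-- The (possibly unnormalised) density matrix `|ψ⟩⟨ψ|`. -/
def density {a b : Type} (ψ : Matrix a b ℂ) : Matrix (a × b) (a × b) ℂ :=
  Matrix.of fun x y => ψ x.1 x.2 * star (ψ y.1 y.2)

/-- The partial trace over Bob's system. -/
def traceBob {a b : Type} [Fintype b] (ρ : Matrix (a × b) (a × b) ℂ) : Matrix a a ℂ :=
  Matrix.of fun i i' => ∑ j, ρ (i, j) (i', j)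

/-- The density matrix that is left of `|ψ⟩⟨ψ|` on `AB` when Alice traces out `A'` and Bob traces
out `B'`, where Alice holds `AA'` and Bob holds `BB'`. -/
def discard {a a' b b' : Type} [Fintype a'] [Fintype b'] (ψ : Matrix (a × a') (b × b') ℂ) :
    Matrix (a × b) (a × b) ℂ :=
  Matrix.of fun x y => ∑ k, ∑ l, ψ (x.1, k) (x.2, l) * star (ψ (y.1, k) (y.2, l))

/-- The Uhlmann fidelity `(Tr √(σ^{1/2} ω σ^{1/2}))²`; matrix square roots are taken with the
functional calculus of Hermitian matrices. -/
def fidelity {ι : Type} [Fintype ι] [DecidableEq ι] (σ ω : Matrix ι ι ℂ) : ℝ :=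
  (Matrix.trace (cfc Real.sqrt (cfc Real.sqrt σ * ω * cfc Real.sqrt σ))).re ^ 2

/-- `log₂ min { |J| · max_{j ∈ J} r_j : ∑_{j ∈ J} r_j ≥ 1 - δ }`, over sets `J` of indices.
For `δ < 1` the empty set never meets the constraint. -/
def spectralDelta {ι : Type} (r : ι → ℝ) (δ : ℝ) : ℝ :=
  Real.logb 2 (sInf {x : ℝ | ∃ (J : Finset ι) (hJ : J.Nonempty),
    1 - δ ≤ ∑ j ∈ J, r j ∧ x = (J.card : ℝ) * J.sup' hJ r})

/-- The robust spectral variation `Δ_δ(ρ)`, computed from the eigenvalues of `ρ`. -/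
def robustDelta {ι : Type} [Fintype ι] [DecidableEq ι] {ρ : Matrix ι ι ℂ} (hρ : ρ.IsHermitian)
    (δ : ℝ) : ℝ :=
  spectralDelta hρ.eigenvalues δ

theorem traceBob_density_isHermitian {a b : Type} [Fintype b] (ψ : Matrix a b ℂ) :
    (traceBob (density ψ)).IsHermitian := by
  ext i i'
  simp [traceBob, density, mul_comm]

/-! ### The states -/

/-- The harmonic sum `H_n`. -/
def harmonicSum (n : ℕ) : ℝ := ∑ i ∈ Finset.Icc 1 n, 1 / (i : ℝ)

/-- `|μ(n)⟩ = H_n^{-1/2} ∑_{i=1}^n i^{-1/2} |i⟩|i⟩`; the basis vector `|i⟩` has index `i - 1`. -/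
def embezzlingState (n : ℕ) : Matrix (Fin n) (Fin n) ℂ :=
  Matrix.of fun i j =>
    if i = j then ((1 / Real.sqrt (harmonicSum n) * (1 / Real.sqrt ((i : ℕ) + 1 : ℝ)) : ℝ) : ℂ)
    else 0

/-- The EPR pair `(|00⟩ + |11⟩)/√2`. -/
def eprPair : Matrix (Fin 2) (Fin 2) ℂ :=
  Matrix.of fun i j => if i = j then ((1 / Real.sqrt 2 : ℝ) : ℂ) else 0

/-- The tensor product of `m` EPR pairs; basis vectors of `m` qubits are numbered by
`Fin (2 ^ m)` through their binary digits. -/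
def eprPairs (m : ℕ) : Matrix (Fin (2 ^ m)) (Fin (2 ^ m)) ℂ :=
  Matrix.of fun i j =>
    ∏ k, eprPair (finFunctionFinEquiv.symm i k) (finFunctionFinEquiv.symm j k)

/-! ### Protocols with quantum communication -/

/-- Alice's subsystem of dimension `d` is handed over to Bob. -/
def sendToBob {p d q : ℕ} (ψ : Matrix (Fin p × Fin d) (Fin q) ℂ) :
    Matrix (Fin p) (Fin (d * q)) ℂ :=
  Matrix.of fun i t => ψ (i, (finProdFinEquiv.symm t).1) (finProdFinEquiv.symm t).2

/-- Bob's subsystem of dimension `d` is handed over to Alice. -/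
def sendToAlice {p d q : ℕ} (ψ : Matrix (Fin p) (Fin d × Fin q) ℂ) :
    Matrix (Fin (p * d)) (Fin q) ℂ :=
  Matrix.of fun t j => ψ (finProdFinEquiv.symm t).1 ((finProdFinEquiv.symm t).2, j)

/-- Protocols with quantum communication that start with systems of dimension `p` (Alice) and `q`
(Bob) and end with systems of dimension `n` on both sides.  In each round one of the parties
applies an isometry (a unitary with ancillas) to the system in her or his hands and sends a
`d`-dimensional subsystem to the other party.  In the end both apply local isometries and trace
out a subsystem. -/
inductive QuantumProtocol (n : ℕ) : ℕ → ℕ → Type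
  | finish {p q a b : ℕ}
      (U : Matrix (Fin n × Fin a) (Fin p) ℂ) (hU : Uᴴ * U = 1)
      (V : Matrix (Fin n × Fin b) (Fin q) ℂ) (hV : Vᴴ * V = 1) : QuantumProtocol n p q
  | alice {p q p' : ℕ} (d : ℕ)
      (U : Matrix (Fin p' × Fin d) (Fin p) ℂ) (hU : Uᴴ * U = 1)
      (next : QuantumProtocol n p' (d * q)) : QuantumProtocol n p q
  | bob {p q q' : ℕ} (d : ℕ)
      (V : Matrix (Fin d × Fin q') (Fin q) ℂ) (hV : Vᴴ * V = 1)
      (next : QuantumProtocol n (p * d) q') : QuantumProtocol n p q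

/-- The final state of the protocol on the initial state `|ψ⟩`. -/
def QuantumProtocol.output {n : ℕ} : {p q : ℕ} → QuantumProtocol n p q →
    Matrix (Fin p) (Fin q) ℂ → Matrix (Fin n × Fin n) (Fin n × Fin n) ℂ
  | _, _, .finish U _ V _, ψ => discard (U * ψ * Vᵀ)
  | _, _, .alice _ U _ next, ψ => next.output (sendToBob (U * ψ))
  | _, _, .bob _ V _ next, ψ => next.output (sendToAlice (ψ * Vᵀ))

/-- The number `∑ log₂ d_i` of qubits that are exchanged. -/
def QuantumProtocol.cost {n : ℕ} : {p q : ℕ} → QuantumProtocol n p q → ℝ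
  | _, _, .finish _ _ _ _ => 0
  | _, _, .alice d _ _ next => Real.logb 2 d + next.cost
  | _, _, .bob d _ _ next => Real.logb 2 d + next.cost

/-! ### Protocols with classical communication (LOCC) -/

/-- Protocols with local operations and classical communication, with dimensions as for
`QuantumProtocol`.  In each round one of the parties performs a measurement with Kraus operators
`M x` and tells the other party the outcome `x`, one of `d`; all later steps may depend on it.
(A measurement result that is not announced is kept as part of the local system until the
final partial trace.) -/
inductive ClassicalProtocol (n : ℕ) : ℕ → ℕ → Type
  | finish {p q a b : ℕ}
      (U : Matrix (Fin n × Fin a) (Fin p) ℂ) (hU : Uᴴ * U = 1)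
      (V : Matrix (Fin n × Fin b) (Fin q) ℂ) (hV : Vᴴ * V = 1) : ClassicalProtocol n p q
  | alice {p q p' : ℕ} (d : ℕ)
      (M : Fin d → Matrix (Fin p') (Fin p) ℂ) (hM : ∑ x, (M x)ᴴ * M x = 1)
      (next : Fin d → ClassicalProtocol n p' q) : ClassicalProtocol n p q
  | bob {p q q' : ℕ} (d : ℕ)
      (M : Fin d → Matrix (Fin q') (Fin q) ℂ) (hM : ∑ x, (M x)ᴴ * M x = 1)
      (next : Fin d → ClassicalProtocol n p q') : ClassicalProtocol n p q

/-- The final state of the protocol on the initial state `|ψ⟩`, averaged over the measurement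
outcomes: the amplitudes are not renormalised after a measurement, so that each branch enters
with its probability. -/
def ClassicalProtocol.output {n : ℕ} : {p q : ℕ} → ClassicalProtocol n p q →
    Matrix (Fin p) (Fin q) ℂ → Matrix (Fin n × Fin n) (Fin n × Fin n) ℂ
  | _, _, .finish U _ V _, ψ => discard (U * ψ * Vᵀ)
  | _, _, .alice _ M _ next, ψ => ∑ x, (next x).output (M x * ψ)
  | _, _, .bob _ M _ next, ψ => ∑ x, (next x).output (ψ * (M x)ᵀ)

/-- The number of classical bits that are exchanged in the worst case; a message with `d`
possible values counts `log₂ d` bits. -/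
def ClassicalProtocol.cost {n : ℕ} : {p q : ℕ} → ClassicalProtocol n p q → ℝ
  | _, _, .finish _ _ _ _ => 0
  | _, _, .alice d _ _ next => Real.logb 2 d + ⨆ x, (next x).cost
  | _, _, .bob d _ _ next => Real.logb 2 d + ⨆ x, (next x).cost

end EntanglementCost

end

/-! The Schmidt weights of `|μ(n)⟩` are proportional to `1/i`, so every multiplicative scale of
indices carries about the same weight, and a window of indices of ratio `y/x` carries only about
`log(y/x)/H_n`. Both kinds of lower bound rest on this.

For communication, let a pure state have squared norm `p`, Schmidt rank at most `R` and largest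
squared Schmidt coefficient at most `Λ`. In the singular basis of the residual state `⟨μ(n)|ψ⟩`,
with singular values `s j`, its overlap with `|μ(n)⟩` is controlled by nonnegative coefficients `c`
paired with the products `t = amplitude n i * s j`. Very large `t` contribute little because `c ≤
√Λ`; very small `t` contribute little because `∑ c ≤ √(R p)`; what remains is a window of
logarithmic length about `log (Λ R / p)`. Hence an overlap well above `p / 2` forces `log (Λ R / p)`
to be of order `H_n` (`overlap_bound_of_coefficients`, `residual_bound`).

EPR pairs have `Λ R = 1` in any number, so they are worthless for this quantity. Sending a
`d`-dimensional system multiplies both `Λ` and `R` by at most `d`, which costs `2 log d`. A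
measurement with `d` outcomes increases neither in the unnormalised branches; splitting the norm `p`
over the branches raises the average of `log (Λ R / p)` by at most `log d`. This is the factor two
between qubits and bits. The resulting bounds have an error linear in `ε`, stronger than the eighth
root wherever the latter says anything.

For the spectral bound, a set of `N` indices with least element `j` has harmonic weight at most
about `log (N / j)`, and `N / j` is, up to `H_n`, the quantity being minimised.

For the matching protocol, Alice applies a randomly shifted Schmidt filter to a maximally entangled
state and Bob undoes the announced shift; every outcome yields `|μ(n)⟩` exactly. -/

namespace EntanglementCost

/-! ### Frobenius norm, operator norm and rank -/

section LinearAlgebra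

open scoped Matrix.Norms.L2Operator ComplexOrder

variable {α β γ : Type} [Fintype α] [Fintype β] [Fintype γ]

/-- The squared Frobenius norm of a matrix. -/
noncomputable def frobSq (A : Matrix α β ℂ) : ℝ := ∑ i, ∑ j, ‖A i j‖ ^ 2

theorem frobSq_nonneg (A : Matrix α β ℂ) : 0 ≤ frobSq A :=
  Finset.sum_nonneg fun _ _ => Finset.sum_nonneg fun _ _ => by positivity

theorem frobSq_conjTranspose (A : Matrix α β ℂ) : frobSq Aᴴ = frobSq A := by
  unfold frobSq
  rw [Finset.sum_comm]
  simp

theorem frobSq_transpose (A : Matrix α β ℂ) : frobSq Aᵀ = frobSq A := by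
  unfold frobSq
  rw [Finset.sum_comm]
  simp

theorem trace_conjTranspose_mul_self (A : Matrix α β ℂ) : (Aᴴ * A).trace = frobSq A := by
  unfold frobSq
  rw [Finset.sum_comm]
  simp only [Matrix.trace, Matrix.diag, Matrix.mul_apply, Matrix.conjTranspose_apply]
  push_cast
  refine Finset.sum_congr rfl fun i _ => Finset.sum_congr rfl fun j _ => ?_
  rw [← Complex.conj_mul']
  rfl

theorem frobSq_mul_le [DecidableEq β] (A : Matrix α β ℂ) (B : Matrix β γ ℂ) :
    frobSq (A * B) ≤ ‖A‖ ^ 2 * frobSq B := by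
  unfold frobSq
  rw [Finset.sum_comm, Finset.sum_comm (γ := β), Finset.mul_sum]
  refine Finset.sum_le_sum fun j _ => ?_
  have h := Matrix.l2_opNorm_mulVec A (WithLp.toLp 2 (fun i => B i j))
  have h2 := pow_le_pow_left₀ (norm_nonneg _) h 2
  rw [mul_pow, EuclideanSpace.norm_sq_eq, EuclideanSpace.norm_sq_eq] at h2
  simpa [Matrix.mulVec, dotProduct, Matrix.mul_apply] using h2

theorem frobSq_mul_le' [DecidableEq α] [DecidableEq β] [DecidableEq γ]
    (A : Matrix α β ℂ) (B : Matrix β γ ℂ) :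
    frobSq (A * B) ≤ frobSq A * ‖B‖ ^ 2 := by
  rw [← frobSq_conjTranspose, Matrix.conjTranspose_mul, mul_comm, ← frobSq_conjTranspose A,
    ← Matrix.l2_opNorm_conjTranspose B]
  exact frobSq_mul_le _ _

/-- The transpose is the adjoint of the entrywise conjugate, and conjugating the argument vector
turns the conjugate matrix back into `A` without changing norms. -/
theorem opNorm_transpose [DecidableEq α] [DecidableEq β] (A : Matrix α β ℂ) : ‖Aᵀ‖ = ‖A‖ := by
  suffices h : ∀ {α β : Type} [Fintype α] [Fintype β] [DecidableEq α] [DecidableEq β]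
      (A : Matrix α β ℂ), ‖Aᵀ‖ ≤ ‖A‖ from
    le_antisymm (h A) (by simpa using h Aᵀ)
  intro α β _ _ _ _ A
  rw [← Matrix.l2_opNorm_conjTranspose Aᵀ, Matrix.l2_opNorm_def]
  refine ContinuousLinearMap.opNorm_le_bound _ (norm_nonneg _) fun x => ?_
  have h := Matrix.l2_opNorm_mulVec A (WithLp.toLp 2 (star x.ofLp))
  have hx : ‖(WithLp.toLp 2 (star x.ofLp) : EuclideanSpace ℂ β)‖ = ‖x‖ := by
    simp [EuclideanSpace.norm_eq]
  rw [hx] at h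
  refine le_trans (le_of_eq ?_) h
  have : Aᵀᴴ = A.map star := by ext; simp
  rw [EuclideanSpace.norm_eq, EuclideanSpace.norm_eq]
  congr 1
  refine Finset.sum_congr rfl fun i _ => ?_
  congr 1
  rw [← norm_star]
  congr 1
  simp [this, Matrix.mulVec, dotProduct]

theorem opNorm_le_one_of_conjTranspose_mul_self [DecidableEq β] {U : Matrix α β ℂ}
    (hU : Uᴴ * U = 1) : ‖U‖ ≤ 1 := by
  have h := Matrix.l2_opNorm_conjTranspose_mul_self U
  rw [hU] at h
  have h1 : ‖(1 : Matrix β β ℂ)‖ ≤ 1 := by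
    rw [← Matrix.diagonal_one, Matrix.l2_opNorm_diagonal, pi_norm_le_iff_of_nonneg zero_le_one]
    simp
  nlinarith [norm_nonneg U]

theorem norm_apply_le_opNorm [DecidableEq α] [DecidableEq β] (A : Matrix α β ℂ) (i : α) (j : β) :
    ‖A i j‖ ≤ ‖A‖ := by
  have h := Matrix.l2_opNorm_mulVec A (EuclideanSpace.single j 1)
  rw [PiLp.norm_single, norm_one, mul_one] at h
  refine le_trans ?_ h
  refine le_trans (le_of_eq ?_) (PiLp.norm_apply_le _ i)
  simp

theorem frobSq_conj_le [DecidableEq α] [DecidableEq β] [DecidableEq γ] {δ : Type} [Fintype δ]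
    [DecidableEq δ] {X : Matrix α γ ℂ} {Y : Matrix β δ ℂ} (hX : ‖X‖ ≤ 1) (hY : ‖Y‖ ≤ 1)
    (A : Matrix α β ℂ) : frobSq (Xᴴ * A * Y) ≤ frobSq A := by
  refine (frobSq_mul_le' _ _).trans ?_
  have h1 := frobSq_mul_le Xᴴ A
  rw [Matrix.l2_opNorm_conjTranspose] at h1
  calc frobSq (Xᴴ * A) * ‖Y‖ ^ 2 ≤ frobSq (Xᴴ * A) * 1 := by
        gcongr
        · exact frobSq_nonneg _
        · exact pow_le_one₀ (norm_nonneg _) hY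
    _ ≤ ‖X‖ ^ 2 * frobSq A := by simpa using h1
    _ ≤ 1 * frobSq A := by
        gcongr
        · exact frobSq_nonneg _
        · exact pow_le_one₀ (norm_nonneg _) hX
    _ = frobSq A := one_mul _

theorem exists_diagonalization [DecidableEq α] {A : Matrix α α ℂ} (hA : A.IsHermitian) :
    ∃ U : Matrix α α ℂ, Uᴴ * U = 1 ∧ U * Uᴴ = 1 ∧
      Uᴴ * A * U = Matrix.diagonal (fun i => (hA.eigenvalues i : ℂ)) := by
  refine ⟨hA.eigenvectorUnitary, ?_, ?_, ?_⟩
  · exact Unitary.coe_star_mul_self hA.eigenvectorUnitary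
  · exact Unitary.coe_mul_star_self hA.eigenvectorUnitary
  · have h := hA.conjStarAlgAut_star_eigenvectorUnitary
    rw [Unitary.conjStarAlgAut_apply] at h
    simp only [Unitary.coe_star, Matrix.star_eq_conjTranspose, Matrix.conjTranspose_conjTranspose] at h
    exact h

/-- In an eigenbasis of `M * Mᴴ` the rows belonging to eigenvalue `0` vanish, so the trace has at
most `rank M` nonzero terms, and Cauchy–Schwarz applies to those. -/
theorem norm_trace_sq_le [DecidableEq α] (M : Matrix α α ℂ) :
    ‖M.trace‖ ^ 2 ≤ M.rank * frobSq M := by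
  have hA : (M * Mᴴ).IsHermitian := Matrix.isHermitian_mul_conjTranspose_self M
  obtain ⟨U, hU, hU', hd⟩ := exists_diagonalization hA
  have hn := opNorm_le_one_of_conjTranspose_mul_self hU
  set N := Uᴴ * M * U with hN
  have htr : M.trace = N.trace := by
    rw [hN, Matrix.trace_mul_comm, ← Matrix.mul_assoc, hU', Matrix.one_mul]
  have hrow : ∀ j, hA.eigenvalues j = 0 → N j j = 0 := by
    intro j hj
    have h1 : ∑ k, ‖(Uᴴ * M) j k‖ ^ 2 = 0 := by
      have h2 := congrFun (congrFun hd j) j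
      rw [Matrix.diagonal_apply_eq, hj] at h2
      have h3 : Uᴴ * (M * Mᴴ) * U = (Uᴴ * M) * (Uᴴ * M)ᴴ := by
        simp [Matrix.mul_assoc]
      rw [h3, Matrix.mul_apply] at h2
      have h4 : ((∑ k, ‖(Uᴴ * M) j k‖ ^ 2 : ℝ) : ℂ) = 0 := by
        rw [← Complex.ofReal_zero, ← h2]
        push_cast
        refine Finset.sum_congr rfl fun k _ => ?_
        rw [← Complex.mul_conj', Matrix.conjTranspose_apply]
        rfl
      exact_mod_cast h4
    have h5 : ∀ k, (Uᴴ * M) j k = 0 := fun k => by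
      have := (Finset.sum_eq_zero_iff_of_nonneg (fun _ _ => by positivity)).1 h1 k
        (Finset.mem_univ k)
      simpa using this
    rw [hN, Matrix.mul_apply]
    exact Finset.sum_eq_zero fun k _ => by rw [h5, zero_mul]
  let S : Finset α := Finset.univ.filter fun j => hA.eigenvalues j ≠ 0
  have hS : (S.card : ℝ) = M.rank := by
    rw [← Matrix.rank_self_mul_conjTranspose, hA.rank_eq_card_non_zero_eigs, Fintype.card_subtype]
  have h6 : N.trace = ∑ j ∈ S, N j j := by
    rw [Matrix.trace, Finset.sum_filter]
    refine Finset.sum_congr rfl fun j _ => ?_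
    by_cases hj : hA.eigenvalues j = 0
    · simp [hj, hrow j hj]
    · simp [hj]
  rw [htr, h6, ← hS]
  calc ‖∑ j ∈ S, N j j‖ ^ 2 ≤ (∑ j ∈ S, ‖N j j‖) ^ 2 := by
        gcongr; exact norm_sum_le _ _
    _ ≤ S.card * ∑ j ∈ S, ‖N j j‖ ^ 2 := sq_sum_le_card_mul_sum_sq
    _ ≤ S.card * frobSq N := by
        gcongr
        calc ∑ j ∈ S, ‖N j j‖ ^ 2 ≤ ∑ j, ‖N j j‖ ^ 2 :=
              Finset.sum_le_univ_sum_of_nonneg fun _ => by positivity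
          _ ≤ frobSq N := Finset.sum_le_sum fun j _ =>
              Finset.single_le_sum (f := fun k => ‖N j k‖ ^ 2) (fun _ _ => by positivity)
                (Finset.mem_univ j)
    _ ≤ S.card * frobSq M := by
        gcongr
        exact frobSq_conj_le hn hn M

/-- A diagonal matrix of phases makes all diagonal entries nonnegative without raising the rank or
the Frobenius norm; the trace bound then applies. -/
theorem sum_norm_diag_le [DecidableEq α] (M : Matrix α α ℂ) :
    ∑ i, ‖M i i‖ ≤ Real.sqrt (M.rank * frobSq M) := by
  let θ : α → ℂ := fun i => if M i i = 0 then 0 else star (M i i) / ‖M i i‖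
  have hθ : ‖Matrix.diagonal θ‖ ≤ 1 := by
    rw [Matrix.l2_opNorm_diagonal, pi_norm_le_iff_of_nonneg zero_le_one]
    intro i
    by_cases h : M i i = 0
    · simp [θ, h]
    · simp [θ, h]
  have h1 : ((∑ i, ‖M i i‖ : ℝ) : ℂ) = (Matrix.diagonal θ * M).trace := by
    rw [Matrix.trace]
    push_cast
    refine Finset.sum_congr rfl fun i _ => ?_
    rw [Matrix.diag_apply, Matrix.diagonal_mul]
    by_cases h : M i i = 0
    · simp [θ, h]
    · have : (‖M i i‖ : ℂ) ≠ 0 := by simpa using h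
      simp only [θ, h, if_false]
      rw [div_mul_eq_mul_div, eq_div_iff this, ← sq, ← Complex.conj_mul']
      rfl
  have h2 := norm_trace_sq_le (Matrix.diagonal θ * M)
  rw [← h1, Complex.norm_real, Real.norm_eq_abs, sq_abs] at h2
  refine Real.le_sqrt_of_sq_le (h2.trans ?_)
  gcongr
  · exact frobSq_nonneg _
  · exact Matrix.rank_mul_le_right _ _
  · refine (frobSq_mul_le _ _).trans ?_
    exact mul_le_of_le_one_left (frobSq_nonneg _) (pow_le_one₀ (norm_nonneg _) hθ)

/-- A singular value decomposition; the singular vectors with singular value `0` are replaced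
by `0` on the left. -/
theorem exists_singular_decomposition [DecidableEq α] [DecidableEq β] (ν : Matrix α β ℂ) :
    ∃ (E : Matrix α β ℂ) (G : Matrix β β ℂ) (e : β → ℂ) (s : β → ℝ), (∀ j, ‖e j‖ ≤ 1) ∧
      Eᴴ * E = Matrix.diagonal e ∧ Gᴴ * G = 1 ∧ (∀ j, 0 ≤ s j) ∧
      (∀ j, (Eᴴ * ν * G) j j = s j) ∧ ∑ j, s j ^ 2 = frobSq ν := by
  have hA : (νᴴ * ν).IsHermitian := Matrix.isHermitian_conjTranspose_mul_self ν
  have h0 : ∀ j, 0 ≤ hA.eigenvalues j :=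
    (Matrix.posSemidef_conjTranspose_mul_self ν).eigenvalues_nonneg
  obtain ⟨U, hU, -, hd⟩ := exists_diagonalization hA
  -- Since `0⁻¹ = 0`, the columns with singular value `0` become `0`, so `Eᴴ * E` is diagonal with
  -- entries `0` and `1`.
  let r : β → ℂ := fun j => ((Real.sqrt (hA.eigenvalues j))⁻¹ : ℝ)
  have hE : (ν * U * Matrix.diagonal r)ᴴ = Matrix.diagonal r * (Uᴴ * νᴴ) := by
    rw [Matrix.conjTranspose_mul, Matrix.conjTranspose_mul, Matrix.diagonal_conjTranspose]
    congr 2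
    ext j
    simp [r]
  refine ⟨ν * U * Matrix.diagonal r, U,
    fun j => r j * hA.eigenvalues j * r j, fun j => Real.sqrt (hA.eigenvalues j),
    fun j => ?_, ?_, hU, fun j => Real.sqrt_nonneg _, fun j => ?_, ?_⟩
  · have : r j * hA.eigenvalues j * r j =
        (((Real.sqrt (hA.eigenvalues j))⁻¹ * hA.eigenvalues j *
          (Real.sqrt (hA.eigenvalues j))⁻¹ : ℝ) : ℂ) := by simp [r]
    simp only [this]
    rw [Complex.norm_real, Real.norm_of_nonneg (by have := h0 j; positivity)]
    have hs := Real.mul_self_sqrt (h0 j)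
    rcases eq_or_ne (Real.sqrt (hA.eigenvalues j)) 0 with h | h
    · simp [h]
    · conv_lhs => enter [1, 2]; rw [← hs]
      field_simp
      rfl
  · rw [hE]
    calc Matrix.diagonal r * (Uᴴ * νᴴ) * (ν * U * Matrix.diagonal r)
        = Matrix.diagonal r * (Uᴴ * (νᴴ * ν) * U) * Matrix.diagonal r := by
          simp only [Matrix.mul_assoc]
      _ = _ := by rw [hd, Matrix.diagonal_mul_diagonal, Matrix.diagonal_mul_diagonal]
  · rw [hE]
    have : Matrix.diagonal r * (Uᴴ * νᴴ) * ν * U = Matrix.diagonal r * (Uᴴ * (νᴴ * ν) * U) := by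
      simp only [Matrix.mul_assoc]
    rw [this, hd, Matrix.diagonal_mul_diagonal, Matrix.diagonal_apply_eq]
    simp only [r]
    rw [← Complex.ofReal_mul]
    congr 1
    rw [inv_mul_eq_div, Real.div_sqrt]
  · have h1 : ∀ j, Real.sqrt (hA.eigenvalues j) ^ 2 = hA.eigenvalues j :=
      fun j => Real.sq_sqrt (h0 j)
    simp only [h1]
    have h2 := hA.trace_eq_sum_eigenvalues
    rw [trace_conjTranspose_mul_self] at h2
    have h3 : ((frobSq ν : ℝ) : ℂ) = ((∑ j, hA.eigenvalues j : ℝ) : ℂ) := by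
      rw [h2]; push_cast; rfl
    exact (Complex.ofReal_injective h3).symm

end LinearAlgebra

/-! ### Harmonic sums -/

theorem inv_add_one_le_log_sub_log {b : ℕ} (hb : 1 ≤ b) :
    1 / ((b : ℝ) + 1) ≤ Real.log (b + 1) - Real.log b := by
  have hb' : (0 : ℝ) < b := by exact_mod_cast hb
  have h := Real.one_sub_inv_le_log_of_pos (x := ((b : ℝ) + 1) / b) (by positivity)
  rw [Real.log_div (by positivity) (by positivity), inv_div] at h
  refine le_trans (le_of_eq ?_) h
  field_simp
  ring

theorem sum_Ioc_inv_le {a b : ℕ} (ha : 1 ≤ a) (hab : a ≤ b) :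
    ∑ i ∈ Finset.Ioc a b, 1 / (i : ℝ) ≤ Real.log b - Real.log a := by
  induction b, hab using Nat.le_induction with
  | base => simp
  | succ b hab ih =>
    rw [Finset.sum_Ioc_succ_top (by omega)]
    have h := inv_add_one_le_log_sub_log (ha.trans hab)
    push_cast
    linarith

theorem sum_Icc_inv_le {a b : ℕ} (ha : 1 ≤ a) (hab : a ≤ b) :
    ∑ i ∈ Finset.Icc a b, 1 / (i : ℝ) ≤ 1 / a + (Real.log b - Real.log a) := by
  rw [← Finset.add_sum_Ioc_eq_sum_Icc hab]
  gcongr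
  exact sum_Ioc_inv_le ha hab

/-- Scale invariance: the bound depends only on the ratio of the endpoints. The summand `1` pays for
the least element of the window. -/
theorem sum_inv_le_of_mem_window {S : Finset ℕ} {x y : ℝ} (hx : 0 < x) (hxy : x ≤ y)
    (hS : ∀ i ∈ S, x ≤ i ∧ (i : ℝ) ≤ y) : ∑ i ∈ S, 1 / (i : ℝ) ≤ 1 + Real.log (y / x) := by
  have hlog : 0 ≤ Real.log (y / x) := Real.log_nonneg ((one_le_div hx).2 hxy)
  rcases S.eq_empty_or_nonempty with rfl | hne
  · simp only [Finset.sum_empty]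
    linarith
  have h1 := hS _ (S.min'_mem hne)
  have h2 := hS _ (S.max'_mem hne)
  have h3 : (0 : ℝ) < (S.min' hne : ℕ) := hx.trans_le h1.1
  have h4 : 1 ≤ S.min' hne := by exact_mod_cast h3
  have h5 : S.min' hne ≤ S.max' hne := S.min'_le _ (S.max'_mem hne)
  have h6 : (0 : ℝ) < (S.max' hne : ℕ) := by exact_mod_cast h4.trans h5
  have hsub : S ⊆ Finset.Icc (S.min' hne) (S.max' hne) := fun i hi =>
    Finset.mem_Icc.2 ⟨S.min'_le i hi, S.le_max' i hi⟩
  calc ∑ i ∈ S, 1 / (i : ℝ) ≤ ∑ i ∈ Finset.Icc (S.min' hne) (S.max' hne), 1 / (i : ℝ) :=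
        Finset.sum_le_sum_of_subset_of_nonneg hsub fun _ _ _ => by positivity
    _ ≤ _ := sum_Icc_inv_le h4 h5
    _ ≤ 1 + Real.log (y / x) := by
        rw [Real.log_div (hx.trans_le hxy).ne' hx.ne']
        have h7 := Real.log_le_log h6 h2.2
        have h8 := Real.log_le_log hx h1.1
        have h9 : 1 / ((S.min' hne : ℕ) : ℝ) ≤ 1 := by
          rw [div_le_one h3]
          exact_mod_cast h4
        linarith

theorem harmonicSum_eq_harmonic (n : ℕ) : harmonicSum n = (harmonic n : ℚ) := by
  rw [harmonic_eq_sum_Icc, harmonicSum]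
  push_cast
  simp

theorem harmonicSum_eq_sum_fin (n : ℕ) : harmonicSum n = ∑ i : Fin n, 1 / ((i : ℕ) + 1 : ℝ) := by
  rw [harmonicSum_eq_harmonic, harmonic, Finset.sum_range]
  push_cast
  simp

theorem harmonicSum_le (n : ℕ) : harmonicSum n ≤ 1 + Real.log n := by
  rw [harmonicSum_eq_harmonic]
  exact harmonic_le_one_add_log n

theorem log_add_one_le_harmonicSum (n : ℕ) : Real.log (n + 1) ≤ harmonicSum n := by
  rw [harmonicSum_eq_harmonic]
  exact_mod_cast log_add_one_le_harmonic n

theorem one_le_harmonicSum {n : ℕ} (hn : 1 ≤ n) : 1 ≤ harmonicSum n := by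
  unfold harmonicSum
  have := Finset.single_le_sum (f := fun i : ℕ => 1 / (i : ℝ)) (s := Finset.Icc 1 n)
    (fun _ _ => by positivity) (Finset.mem_Icc.2 ⟨le_rfl, hn⟩)
  simpa using this

/-! ### The overlap bound -/

/-- The Schmidt coefficients of `|μ(n)⟩`. -/
noncomputable def amplitude (n : ℕ) (i : Fin n) : ℝ :=
  1 / Real.sqrt (harmonicSum n) * (1 / Real.sqrt ((i : ℕ) + 1 : ℝ))

theorem amplitude_nonneg (n : ℕ) (i : Fin n) : 0 ≤ amplitude n i := by
  unfold amplitude; positivity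

theorem amplitude_sq {n : ℕ} (hn : 1 ≤ n) (i : Fin n) :
    amplitude n i ^ 2 = 1 / ((i : ℕ) + 1 : ℝ) / harmonicSum n := by
  have := one_le_harmonicSum hn
  unfold amplitude
  rw [mul_pow, div_pow, div_pow, Real.sq_sqrt (by linarith), Real.sq_sqrt (by positivity)]
  field_simp

theorem sum_amplitude_sq {n : ℕ} (hn : 1 ≤ n) : ∑ i, amplitude n i ^ 2 = 1 := by
  have := one_le_harmonicSum hn
  simp only [amplitude_sq hn]
  rw [← Finset.sum_div, ← harmonicSum_eq_sum_fin, div_self (by linarith)]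

/-- The condition on `amplitude n i * σ` confines the index to a window whose endpoints have ratio
`(a / b) ^ 2`. The scale `σ` cancels, which makes the bound uniform over the singular values of the
residual state. -/
theorem sum_amplitude_sq_window {n : ℕ} (hn : 1 ≤ n) {σ a b : ℝ} (hσ : 0 ≤ σ) (hb : 0 < b)
    (hab : b ≤ a) :
    ∑ i with b ≤ amplitude n i * σ ∧ amplitude n i * σ ≤ a, amplitude n i ^ 2 ≤
      (1 + 2 * Real.log (a / b)) / harmonicSum n := by
  have hH := one_le_harmonicSum hn
  have ha : 0 < a := hb.trans_le hab
  have hlog : 0 ≤ Real.log (a / b) := Real.log_nonneg ((one_le_div hb).2 hab)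
  rcases hσ.eq_or_lt with rfl | hσ
  · rw [Finset.sum_eq_zero]
    · have : 0 < harmonicSum n := by linarith
      positivity
    · intro i hi
      have := (Finset.mem_filter.1 hi).2.1
      simp only [mul_zero] at this
      linarith
  simp only [amplitude_sq hn]
  rw [← Finset.sum_div]
  gcongr
  set T : Finset (Fin n) :=
    Finset.univ.filter fun i => b ≤ amplitude n i * σ ∧ amplitude n i * σ ≤ a with hT
  have hinj : Set.InjOn (fun i : Fin n => (i : ℕ) + 1) T := fun i _ j _ h => by
    simpa [Fin.ext_iff] using h
  have h1 : ∑ i ∈ T, 1 / ((i : ℕ) + 1 : ℝ) =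
      ∑ k ∈ T.image (fun i : Fin n => (i : ℕ) + 1), 1 / (k : ℝ) := by
    rw [Finset.sum_image hinj]
    push_cast
    rfl
  rw [h1]
  refine (sum_inv_le_of_mem_window (x := σ ^ 2 / (harmonicSum n * a ^ 2))
    (y := σ ^ 2 / (harmonicSum n * b ^ 2)) (by positivity) (by gcongr) ?_).trans ?_
  · intro k hk
    obtain ⟨i, hi, rfl⟩ := Finset.mem_image.1 hk
    obtain ⟨hi1, hi2⟩ := (Finset.mem_filter.1 hi).2
    have h0 : 0 ≤ amplitude n i * σ := mul_nonneg (amplitude_nonneg n i) hσ.le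
    have e : (amplitude n i * σ) ^ 2 = σ ^ 2 / (harmonicSum n * ((i : ℕ) + 1 : ℝ)) := by
      rw [mul_pow, amplitude_sq hn]
      field_simp
    have h2 := pow_le_pow_left₀ hb.le hi1 2
    have h3 := pow_le_pow_left₀ h0 hi2 2
    rw [e, le_div_iff₀ (by positivity)] at h2
    rw [e, div_le_iff₀ (by positivity)] at h3
    push_cast
    constructor
    · rw [div_le_iff₀ (by positivity)]
      linarith
    · rw [le_div_iff₀ (by positivity)]
      linarith
  · have : σ ^ 2 / (harmonicSum n * b ^ 2) / (σ ^ 2 / (harmonicSum n * a ^ 2)) = (a / b) ^ 2 := by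
      field_simp
    rw [this, Real.log_pow]
    push_cast
    exact le_rfl

/-- The bound behind all the lower bounds on communication: coefficients `c` that are bounded
by `√Λ`, and by `√(R p)` in sum, overlap with `amplitude n i * s j` only through a window of
logarithmic length `log (Λ R / p)`, up to lower order terms. -/
theorem overlap_bound_of_coefficients {n : ℕ} (hn : 1 ≤ n) {κ : Type} [Fintype κ]
    (s : κ → ℝ) (c : Fin n × κ → ℝ) (hs : ∀ j, 0 ≤ s j) (hc : ∀ x, 0 ≤ c x) {Λ R p : ℝ}
    (hp : 0 < p) (hR : 0 < R) (hΛ : 0 < Λ) (hpR : p ≤ Λ * R)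
    (hmax : ∀ x, c x ≤ Real.sqrt Λ) (hsq : ∑ x, c x ^ 2 ≤ p)
    (hsum : ∑ x, c x ≤ Real.sqrt (R * p))
    (hF : ∑ j, s j ^ 2 ≤ ∑ x, amplitude n x.1 * s x.2 * c x) :
    (2 * ∑ j, s j ^ 2 - p) * harmonicSum n ≤
      p * (5 + 4 * Real.log (harmonicSum n) + Real.log (Λ * R / p)) := by
  have hH := one_le_harmonicSum hn
  set H := harmonicSum n with hHdef
  have hH0 : 0 < H := by linarith
  set F := ∑ j, s j ^ 2 with hFdef
  set t : Fin n × κ → ℝ := fun x => amplitude n x.1 * s x.2 with ht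
  have ht0 : ∀ x, 0 ≤ t x := fun x => mul_nonneg (amplitude_nonneg _ _) (hs _)
  have htsq : ∑ x, t x ^ 2 = F := by
    rw [Fintype.sum_prod_type_right]
    simp only [ht, mul_pow, ← Finset.sum_mul]
    simp [sum_amplitude_sq hn, hFdef]
  have hFp : F ≤ p := by
    have : ∑ x, t x * c x ≤ ∑ x, (t x ^ 2 / 2 + c x ^ 2 / 2) :=
      Finset.sum_le_sum fun x _ => by nlinarith [sq_nonneg (t x - c x)]
    rw [Finset.sum_add_distrib, ← Finset.sum_div, ← Finset.sum_div, htsq] at this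
    linarith
  -- The thresholds are set so that each tail costs at most `p / H`: above `a`, `c ≤ √Λ = a / H ≤ t
  -- / H`; below `b`, the total is at most `b * √(R p) = p / H`.
  set a := H * Real.sqrt Λ with ha
  set b := Real.sqrt p / (H * Real.sqrt R) with hb
  have hsp : 0 < Real.sqrt p := Real.sqrt_pos.2 hp
  have hsR : 0 < Real.sqrt R := Real.sqrt_pos.2 hR
  have hsΛ : 0 < Real.sqrt Λ := Real.sqrt_pos.2 hΛ
  have hb0 : 0 < b := by positivity
  have ha0 : 0 < a := by positivity
  have hab' : a / b = H ^ 2 * Real.sqrt (Λ * R / p) := by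
    rw [Real.sqrt_div (by positivity), Real.sqrt_mul hΛ.le, ha, hb]
    field_simp
  have hab : b ≤ a := by
    rw [← one_le_div hb0, hab']
    have : 1 ≤ Real.sqrt (Λ * R / p) := by
      rw [Real.one_le_sqrt, one_le_div hp]; exact hpR
    nlinarith [one_le_pow₀ hH (n := 2)]
  have hlog : 2 * Real.log (a / b) = 4 * Real.log H + Real.log (Λ * R / p) := by
    rw [hab', Real.log_mul (by positivity) (by positivity), Real.log_pow,
      Real.log_sqrt (by positivity)]
    push_cast; ring
  have hbR : b * Real.sqrt (R * p) = p / H := by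
    rw [hb, Real.sqrt_mul hR.le]
    have := Real.mul_self_sqrt hp.le
    field_simp
    linarith
  -- The three regimes in one inequality; inside the window it is `t c ≤ t² / 2 + c² / 2`. The `c²`
  -- terms sum to at most `p / 2`, the source of the loss in `2F - p`.
  have hpt : ∀ x, t x * c x ≤ t x ^ 2 / H + b * c x + c x ^ 2 / 2 +
      (if b ≤ t x ∧ t x ≤ a then t x ^ 2 else 0) / 2 := by
    intro x
    have h1 : 0 ≤ t x ^ 2 / H := by positivity
    have h2 : 0 ≤ b * c x := mul_nonneg hb0.le (hc x)
    have h3 : 0 ≤ c x ^ 2 := sq_nonneg _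
    by_cases hx1 : t x < b
    · have : t x * c x ≤ b * c x := mul_le_mul_of_nonneg_right hx1.le (hc x)
      have h4 : (0 : ℝ) ≤ if b ≤ t x ∧ t x ≤ a then t x ^ 2 else 0 := by positivity
      linarith
    by_cases hx2 : t x ≤ a
    · rw [if_pos ⟨not_lt.1 hx1, hx2⟩]
      nlinarith [sq_nonneg (t x - c x)]
    · have h4 : (0 : ℝ) ≤ if b ≤ t x ∧ t x ≤ a then t x ^ 2 else 0 := by positivity
      have h5 : t x * c x ≤ t x ^ 2 / H := by
        rw [le_div_iff₀ hH0, sq, mul_assoc]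
        refine mul_le_mul_of_nonneg_left ?_ (ht0 x)
        calc c x * H ≤ Real.sqrt Λ * H := by gcongr; exact hmax x
          _ = a := by rw [ha, mul_comm]
          _ ≤ t x := (not_le.1 hx2).le
      linarith
  have hW : ∑ x, (if b ≤ t x ∧ t x ≤ a then t x ^ 2 else 0) ≤
      F * ((1 + 2 * Real.log (a / b)) / H) := by
    rw [Fintype.sum_prod_type_right, hFdef, Finset.sum_mul]
    refine Finset.sum_le_sum fun j _ => ?_
    have := mul_le_mul_of_nonneg_left
      (sum_amplitude_sq_window hn (hs j) hb0 hab) (sq_nonneg (s j))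
    refine le_trans (le_of_eq ?_) this
    rw [Finset.mul_sum, Finset.sum_filter]
    refine Finset.sum_congr rfl fun i _ => ?_
    simp only [ht, mul_pow]
    split_ifs
    · ring
    · rfl
  have hW' : 0 ≤ (1 + 2 * Real.log (a / b)) / H := by
    have : 0 ≤ Real.log (a / b) := Real.log_nonneg ((one_le_div hb0).2 hab)
    positivity
  have htot := hF.trans (Finset.sum_le_sum fun x _ => hpt x)
  simp only [Finset.sum_add_distrib, ← Finset.sum_div, ← Finset.mul_sum, htsq] at htot
  have h1 : b * ∑ x, c x ≤ p / H := by
    rw [← hbR]; gcongr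
  have h2 : F / H ≤ p / H := by gcongr
  have h3 := mul_le_mul_of_nonneg_right hFp hW'
  have h4 : 2 * F - p ≤ 4 * (p / H) + p * ((1 + 2 * Real.log (a / b)) / H) := by linarith
  calc (2 * F - p) * H ≤ (4 * (p / H) + p * ((1 + 2 * Real.log (a / b)) / H)) * H := by gcongr
    _ = p * (5 + 2 * Real.log (a / b)) := by field_simp; ring
    _ = _ := by rw [hlog, add_assoc]

/-! ### Overlap of a pure state on larger systems with `|μ(n)⟩` -/

section Overlap

open scoped Matrix.Norms.L2Operator ComplexOrder Kronecker

theorem opNorm_one_kronecker_le {n : ℕ} {κ l : Type} [Fintype κ] [Fintype l] [DecidableEq κ]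
    [DecidableEq l] {E : Matrix κ l ℂ} {e : l → ℂ} (he : ∀ j, ‖e j‖ ≤ 1)
    (hE : Eᴴ * E = Matrix.diagonal e) : ‖(1 : Matrix (Fin n) (Fin n) ℂ) ⊗ₖ E‖ ≤ 1 := by
  have h := Matrix.l2_opNorm_conjTranspose_mul_self ((1 : Matrix (Fin n) (Fin n) ℂ) ⊗ₖ E)
  rw [Matrix.conjTranspose_kronecker, ← Matrix.mul_kronecker_mul, hE, Matrix.conjTranspose_one,
    Matrix.one_mul, ← Matrix.diagonal_one, Matrix.diagonal_kronecker_diagonal,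
    Matrix.l2_opNorm_diagonal] at h
  have h1 : ‖(fun mn : Fin n × l => (1 : ℂ) * e mn.2)‖ ≤ 1 := by
    rw [pi_norm_le_iff_of_nonneg zero_le_one]
    intro x
    simpa using he x.2
  rw [h, Matrix.diagonal_one] at h1
  nlinarith [norm_nonneg ((1 : Matrix (Fin n) (Fin n) ℂ) ⊗ₖ E)]

theorem one_kronecker_conj_apply {n : ℕ} {κ l σ τ : Type} [Fintype κ] [Fintype l]
    (E : Matrix κ σ ℂ) (G : Matrix l τ ℂ) (ψ : Matrix (Fin n × κ) (Fin n × l) ℂ)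
    (i i' : Fin n) (j : σ) (j' : τ) :
    (((1 : Matrix (Fin n) (Fin n) ℂ) ⊗ₖ E)ᴴ * ψ * ((1 : Matrix (Fin n) (Fin n) ℂ) ⊗ₖ G))
      (i, j) (i', j') = (Eᴴ * Matrix.of (fun k m => ψ (i, k) (i', m)) * G) j j' := by
  simp only [Matrix.mul_apply, Matrix.conjTranspose_apply, Matrix.kroneckerMap_apply,
    Fintype.sum_prod_type, Matrix.one_apply, Matrix.of_apply, ite_mul, one_mul, zero_mul, apply_ite star, star_zero]
  simp

/-- The state `⟨μ(n)|ψ⟩` of the systems that are traced out. -/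
noncomputable def residual {n : ℕ} {κ l : Type} (ψ : Matrix (Fin n × κ) (Fin n × l) ℂ) :
    Matrix κ l ℂ :=
  ∑ i, (amplitude n i : ℂ) • Matrix.of (fun k m => ψ (i, k) (i, m))

/-- Conjugating by `1 ⊗ E` and `1 ⊗ G`, with `E`, `G` from the singular decomposition of the
residual state, raises neither norms nor rank. The diagonal entries of the result, weighted by the
amplitudes, sum over `i` to `s j`, so their absolute values serve as the coefficients `c`. -/
theorem residual_bound {n : ℕ} (hn : 1 ≤ n) {κ l : Type} [Fintype κ] [Fintype l] [DecidableEq κ]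
    [DecidableEq l] (ψ : Matrix (Fin n × κ) (Fin n × l) ℂ) {Λ R : ℝ} (hp : 0 < frobSq ψ)
    (hR : (ψ.rank : ℝ) ≤ R) (hΛ : ‖ψ‖ ^ 2 ≤ Λ) (hpR : frobSq ψ ≤ Λ * R) :
    (2 * frobSq (residual ψ) - frobSq ψ) * harmonicSum n ≤
      frobSq ψ * (5 + 4 * Real.log (harmonicSum n) + Real.log (Λ * R / frobSq ψ)) := by
  obtain ⟨E, G, e, s, he, hE, hG, hs, hsE, hsum⟩ := exists_singular_decomposition (residual ψ)
  have hΛ0 : 0 ≤ Λ := (sq_nonneg _).trans hΛ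
  have hR0 : 0 ≤ R := (Nat.cast_nonneg _).trans hR
  have hprod : 0 < Λ * R := hp.trans_le hpR
  have hΛ1 : 0 < Λ := hΛ0.lt_of_ne fun h => by simp [← h] at hprod
  have hR1 : 0 < R := hR0.lt_of_ne fun h => by simp [← h] at hprod
  set X := (1 : Matrix (Fin n) (Fin n) ℂ) ⊗ₖ E with hX
  set Y := (1 : Matrix (Fin n) (Fin n) ℂ) ⊗ₖ G with hY
  have hXn : ‖X‖ ≤ 1 := opNorm_one_kronecker_le he hE
  have hYn : ‖Y‖ ≤ 1 := opNorm_one_kronecker_le (e := fun _ => 1) (by simp)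
    (by rw [hG, Matrix.diagonal_one])
  set C := Xᴴ * ψ * Y with hC
  have hCp : frobSq C ≤ frobSq ψ := frobSq_conj_le hXn hYn ψ
  have hCn : ‖C‖ ≤ ‖ψ‖ := by
    calc ‖C‖ ≤ ‖Xᴴ‖ * ‖ψ‖ * ‖Y‖ := (Matrix.l2_opNorm_mul _ _).trans
          (mul_le_mul_of_nonneg_right (Matrix.l2_opNorm_mul _ _) (norm_nonneg _))
      _ ≤ 1 * ‖ψ‖ * 1 := by
          rw [Matrix.l2_opNorm_conjTranspose]
          gcongr
      _ = ‖ψ‖ := by ring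
  have hCr : C.rank ≤ ψ.rank :=
    (Matrix.rank_mul_le_left _ _).trans (Matrix.rank_mul_le_right _ _)
  have hkey := overlap_bound_of_coefficients hn s (fun x => ‖C x x‖) hs (fun _ => norm_nonneg _)
    hp hR1 hΛ1 hpR
    (fun x => Real.le_sqrt_of_sq_le ((pow_le_pow_left₀ (norm_nonneg _)
      ((norm_apply_le_opNorm C x x).trans hCn) 2).trans hΛ))
    (by
      refine le_trans (Finset.sum_le_sum fun x _ => ?_) hCp
      exact Finset.single_le_sum (f := fun y => ‖C x y‖ ^ 2) (fun _ _ => by positivity)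
        (Finset.mem_univ x))
    (by
      refine (sum_norm_diag_le C).trans (Real.sqrt_le_sqrt ?_)
      have : (C.rank : ℝ) ≤ R := le_trans (by exact_mod_cast hCr) hR
      exact mul_le_mul this hCp (frobSq_nonneg _) hR0)
    (by
      rw [Fintype.sum_prod_type_right]
      refine Finset.sum_le_sum fun j _ => ?_
      have h1 : (s j : ℂ) = ∑ i, (amplitude n i : ℂ) * C (i, j) (i, j) := by
        rw [← hsE j, residual, Matrix.mul_sum, Matrix.sum_mul, Matrix.sum_apply]
        refine Finset.sum_congr rfl fun i _ => ?_
        rw [hC, hX, hY, one_kronecker_conj_apply, Matrix.mul_smul, Matrix.smul_mul,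
          Matrix.smul_apply, smul_eq_mul]
      have h2 : s j ≤ ∑ i, amplitude n i * ‖C (i, j) (i, j)‖ := by
        calc s j = ‖(s j : ℂ)‖ := by rw [Complex.norm_real, Real.norm_of_nonneg (hs j)]
          _ ≤ ∑ i, ‖(amplitude n i : ℂ) * C (i, j) (i, j)‖ := by
              rw [h1]; exact norm_sum_le _ _
          _ = _ := Finset.sum_congr rfl fun i _ => by
              rw [norm_mul, Complex.norm_real, Real.norm_of_nonneg (amplitude_nonneg n i)]
      calc s j ^ 2 = s j * s j := sq _
        _ ≤ s j * ∑ i, amplitude n i * ‖C (i, j) (i, j)‖ :=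
            mul_le_mul_of_nonneg_left h2 (hs j)
        _ = _ := by
            rw [Finset.mul_sum]
            exact Finset.sum_congr rfl fun i _ => by ring)
  rwa [hsum] at hkey

/-! ### Fidelity with a pure state -/

/-- The amplitudes of a bipartite pure state as a vector. -/
def vec {a b : Type} (φ : Matrix a b ℂ) (x : a × b) : ℂ := φ x.1 x.2

/-- `⟨φ|ω|φ⟩`. -/
noncomputable def overlap {a b : Type} [Fintype a] [Fintype b] (φ : Matrix a b ℂ)
    (ω : Matrix (a × b) (a × b) ℂ) : ℝ :=
  (star (vec φ) ⬝ᵥ ω *ᵥ vec φ).re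

theorem density_eq_vecMulVec {a b : Type} (φ : Matrix a b ℂ) :
    density φ = Matrix.vecMulVec (vec φ) (star (vec φ)) := by
  ext x y
  simp [density, Matrix.vecMulVec_apply, vec]

theorem star_vec_dotProduct_vec {a b : Type} [Fintype a] [Fintype b] (φ : Matrix a b ℂ) :
    star (vec φ) ⬝ᵥ vec φ = (frobSq φ : ℂ) := by
  rw [frobSq, dotProduct, Fintype.sum_prod_type]
  push_cast
  refine Finset.sum_congr rfl fun i _ => Finset.sum_congr rfl fun j _ => ?_
  rw [← Complex.conj_mul']
  rfl

/-- For the rank-one projection `P = density φ` one has `√P = P` and `P ω P = ⟨φ|ω|φ⟩ P`, whose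
square root has trace `√⟨φ|ω|φ⟩`. -/
theorem fidelity_density {a b : Type} [Fintype a] [Fintype b] [DecidableEq a] [DecidableEq b]
    {φ : Matrix a b ℂ} (hφ : frobSq φ = 1) {ω : Matrix (a × b) (a × b) ℂ} (hω : ω.PosSemidef) :
    fidelity (density φ) ω = overlap φ ω := by
  have hnorm : star (vec φ) ⬝ᵥ vec φ = 1 := by
    rw [star_vec_dotProduct_vec, hφ, Complex.ofReal_one]
  set P := density φ with hP
  have hPeq : P = Matrix.vecMulVec (vec φ) (star (vec φ)) := density_eq_vecMulVec φ
  have hPP : P * P = P := by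
    rw [hPeq, Matrix.vecMulVec_mul_vecMulVec, hnorm, one_smul]
  have hPs : IsSelfAdjoint P := by
    rw [isSelfAdjoint_iff, hPeq, Matrix.star_eq_conjTranspose, Matrix.conjTranspose_vecMulVec,
      star_star]
  -- The spectrum of an idempotent lies in `{0, 1}`, so a function vanishing at `0` acts on `P` as
  -- multiplication by its value at `1`.
  have hcfc : ∀ (f : ℝ → ℝ) (r : ℝ), f 0 = 0 → f 1 = r → cfc f P = r • P := by
    intro f r h0 h1
    rw [← cfc_const_mul_id r P hPs]
    refine cfc_congr fun x hx => ?_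
    have hx2 : x = 0 ∨ x = 1 := by
      have := IsIdempotentElem.spectrum_subset ℝ (p := P) hPP hx
      simpa using this
    rcases hx2 with rfl | rfl
    · simp [h0]
    · simp [h1]
  have hz := hω.dotProduct_mulVec_nonneg (vec φ)
  set z := star (vec φ) ⬝ᵥ ω *ᵥ vec φ with hzdef
  obtain ⟨hz1, hz2⟩ := Complex.nonneg_iff.1 hz
  have hzre : z = ((overlap φ ω : ℝ) : ℂ) := by
    apply Complex.ext
    · rfl
    · simp [← hz2]
  have hov : 0 ≤ overlap φ ω := hz1
  have hsand : P * ω * P = (overlap φ ω) • P := by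
    rw [hPeq, Matrix.mul_assoc, Matrix.mul_vecMulVec, Matrix.vecMulVec_mul_vecMulVec, ← hzdef,
      hzre]
    ext i j
    simp
  have htr : P.trace = 1 := by
    rw [hPeq, Matrix.trace_vecMulVec, dotProduct_comm, hnorm]
  rw [fidelity, hcfc Real.sqrt 1 (by simp) (by simp), one_smul, hsand,
    ← cfc_comp_smul (overlap φ ω) Real.sqrt P (Real.continuous_sqrt.continuousOn) hPs,
    hcfc _ (Real.sqrt (overlap φ ω)) (by simp) (by simp), Matrix.trace_smul, htr]
  simp [Real.sq_sqrt hov]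

theorem frobSq_embezzlingState {n : ℕ} (hn : 1 ≤ n) : frobSq (embezzlingState n) = 1 := by
  rw [frobSq, ← sum_amplitude_sq hn]
  refine Finset.sum_congr rfl fun i _ => ?_
  rw [Finset.sum_eq_single i]
  · rw [embezzlingState, Matrix.of_apply, if_pos rfl, Complex.norm_real, Real.norm_eq_abs, sq_abs,
      amplitude]
  · intro j _ hj
    simp [embezzlingState, hj.symm]
  · simp

theorem discard_eq_sum {a a' b b' : Type} [Fintype a'] [Fintype b']
    (ψ : Matrix (a × a') (b × b') ℂ) :
    discard ψ = ∑ k, ∑ l, density (Matrix.of fun i j => ψ (i, k) (j, l)) := by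
  ext x y
  simp [discard, density, Matrix.sum_apply]

theorem posSemidef_density {a b : Type} [Fintype a] [Fintype b] (φ : Matrix a b ℂ) :
    (density φ).PosSemidef := by
  rw [density_eq_vecMulVec]
  exact Matrix.posSemidef_vecMulVec_self_star _

theorem posSemidef_discard {a a' b b' : Type} [Fintype a] [Fintype b] [Fintype a'] [Fintype b']
    (ψ : Matrix (a × a') (b × b') ℂ) : (discard ψ).PosSemidef := by
  rw [discard_eq_sum]
  exact Matrix.posSemidef_sum _ fun _ _ => Matrix.posSemidef_sum _ fun _ _ => posSemidef_density _

theorem overlap_sum {a b ι : Type} [Fintype a] [Fintype b] (φ : Matrix a b ℂ) (S : Finset ι)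
    (ω : ι → Matrix (a × b) (a × b) ℂ) : overlap φ (∑ x ∈ S, ω x) = ∑ x ∈ S, overlap φ (ω x) := by
  unfold overlap
  rw [Matrix.sum_mulVec, dotProduct_sum, Complex.re_sum]

theorem overlap_density {a b : Type} [Fintype a] [Fintype b] (φ χ : Matrix a b ℂ) :
    overlap φ (density χ) = ‖star (vec φ) ⬝ᵥ vec χ‖ ^ 2 := by
  have h : star (vec χ) ⬝ᵥ vec φ = star (star (vec φ) ⬝ᵥ vec χ) := by
    rw [Matrix.star_dotProduct]
  rw [overlap, density_eq_vecMulVec, Matrix.vecMulVec_mulVec, dotProduct_smul, h]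
  have : MulOpposite.op (star (star (vec φ) ⬝ᵥ vec χ)) • (star (vec φ) ⬝ᵥ vec χ) =
      ((‖star (vec φ) ⬝ᵥ vec χ‖ ^ 2 : ℝ) : ℂ) := by
    rw [op_smul_eq_mul]
    push_cast
    rw [← Complex.mul_conj']
    rfl
  rw [this, Complex.ofReal_re]

/-- Tracing out sums over basis states of the discarded registers; each term is the squared modulus
of one entry of the residual state. -/
theorem overlap_embezzlingState_discard {n : ℕ} {κ l : Type} [Fintype κ] [Fintype l]
    (ψ : Matrix (Fin n × κ) (Fin n × l) ℂ) :
    overlap (embezzlingState n) (discard ψ) = frobSq (residual ψ) := by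
  rw [discard_eq_sum, overlap_sum, frobSq]
  refine Finset.sum_congr rfl fun k _ => ?_
  rw [overlap_sum]
  refine Finset.sum_congr rfl fun m _ => ?_
  rw [overlap_density]
  congr 2
  rw [dotProduct, Fintype.sum_prod_type, residual, Matrix.sum_apply]
  refine Finset.sum_congr rfl fun i _ => ?_
  rw [Finset.sum_eq_single i]
  · simp [vec, embezzlingState, amplitude]
  · intro j _ hj
    simp [vec, embezzlingState, hj.symm]
  · simp

end Overlap

section Protocols

open scoped Matrix.Norms.L2Operator ComplexOrder

/-! ### Effect of the local operations -/

theorem sum_frobSq_mul {ι α β γ : Type} [Fintype ι] [Fintype α] [Fintype β] [Fintype γ]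
    [DecidableEq β] {M : ι → Matrix α β ℂ} (hM : ∑ x, (M x)ᴴ * M x = 1) (ψ : Matrix β γ ℂ) :
    ∑ x, frobSq (M x * ψ) = frobSq ψ := by
  have h : (∑ x, ((frobSq (M x * ψ) : ℝ) : ℂ)) = (frobSq ψ : ℝ) := by
    simp only [← trace_conjTranspose_mul_self]
    rw [← Matrix.trace_sum]
    congr 1
    calc ∑ x, (M x * ψ)ᴴ * (M x * ψ) = ∑ x, ψᴴ * ((M x)ᴴ * M x) * ψ :=
          Finset.sum_congr rfl fun x _ => by simp only [Matrix.conjTranspose_mul, Matrix.mul_assoc]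
      _ = ψᴴ * ψ := by rw [← Matrix.sum_mul, ← Matrix.mul_sum, hM, Matrix.mul_one]
  exact_mod_cast h

theorem sum_frobSq_mul_transpose {ι α β γ : Type} [Fintype ι] [Fintype α] [Fintype β] [Fintype γ]
    [DecidableEq β] {M : ι → Matrix α β ℂ} (hM : ∑ x, (M x)ᴴ * M x = 1) (ψ : Matrix γ β ℂ) :
    ∑ x, frobSq (ψ * (M x)ᵀ) = frobSq ψ := by
  rw [← frobSq_transpose ψ, ← sum_frobSq_mul hM]
  refine Finset.sum_congr rfl fun x _ => ?_
  rw [← frobSq_transpose, Matrix.transpose_mul, Matrix.transpose_transpose]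

theorem frobSq_isometry_mul {α β γ : Type} [Fintype α] [Fintype β] [Fintype γ]
    [DecidableEq β] {U : Matrix α β ℂ} (hU : Uᴴ * U = 1) (ψ : Matrix β γ ℂ) :
    frobSq (U * ψ) = frobSq ψ := by
  simpa using sum_frobSq_mul (M := fun _ : Unit => U) (by simpa using hU) ψ

theorem frobSq_mul_isometry_transpose {α β γ : Type} [Fintype α] [Fintype β] [Fintype γ]
    [DecidableEq β] {U : Matrix α β ℂ} (hU : Uᴴ * U = 1) (ψ : Matrix γ β ℂ) :
    frobSq (ψ * Uᵀ) = frobSq ψ := by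
  simpa using sum_frobSq_mul_transpose (M := fun _ : Unit => U) (by simpa using hU) ψ

/-- A vector is a matrix with one column, and by completeness the squared norms of its images under
all Kraus operators sum to its own. -/
theorem opNorm_kraus_le_one {ι α β : Type} [Fintype ι] [Fintype α] [Fintype β]
    [DecidableEq β] {M : ι → Matrix α β ℂ} (hM : ∑ x, (M x)ᴴ * M x = 1) (x : ι) : ‖M x‖ ≤ 1 := by
  rw [Matrix.l2_opNorm_def]
  refine ContinuousLinearMap.opNorm_le_bound _ zero_le_one fun v => ?_
  rw [one_mul]
  have h := sum_frobSq_mul hM (Matrix.of fun i (_ : Unit) => v i)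
  have h1 := Finset.single_le_sum (f := fun y => frobSq (M y * Matrix.of fun i (_ : Unit) => v i))
    (fun y _ => frobSq_nonneg _) (Finset.mem_univ x)
  rw [h] at h1
  refine (sq_le_sq₀ (norm_nonneg _) (norm_nonneg _)).1 ?_
  rw [EuclideanSpace.norm_sq_eq, EuclideanSpace.norm_sq_eq]
  simpa [frobSq, Matrix.mulVec, dotProduct, Matrix.mul_apply] using h1

/-! ### Schmidt rank and largest Schmidt coefficient under local maps and transfers -/

/-- The Schmidt rank of `ψ` is at most `R` and its squared Schmidt coefficients are at most `Λ`. -/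
def SchmidtBounded {α β : Type} [Fintype α] [Fintype β] [DecidableEq β] (ψ : Matrix α β ℂ)
    (Λ R : ℝ) : Prop :=
  ‖ψ‖ ^ 2 ≤ Λ ∧ (ψ.rank : ℝ) ≤ R

namespace SchmidtBounded

variable {α β γ : Type} [Fintype α] [Fintype β] [Fintype γ] [DecidableEq α] [DecidableEq β]
  {ψ : Matrix α β ℂ} {Λ R : ℝ}

theorem transpose (h : SchmidtBounded ψ Λ R) : SchmidtBounded ψᵀ Λ R :=
  ⟨by rw [opNorm_transpose]; exact h.1, by rw [Matrix.rank_transpose]; exact h.2⟩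

theorem mul_left (h : SchmidtBounded ψ Λ R) {M : Matrix γ α ℂ} (hM : ‖M‖ ≤ 1) :
    SchmidtBounded (M * ψ) Λ R := by
  have h1 : ‖M * ψ‖ ≤ ‖ψ‖ :=
    (Matrix.l2_opNorm_mul M ψ).trans (mul_le_of_le_one_left (norm_nonneg _) hM)
  have h2 : ((M * ψ).rank : ℝ) ≤ ψ.rank := by exact_mod_cast Matrix.rank_mul_le_right M ψ
  exact ⟨(pow_le_pow_left₀ (norm_nonneg _) h1 2).trans h.1, h2.trans h.2⟩

theorem mul_transpose [DecidableEq γ] (h : SchmidtBounded ψ Λ R) {M : Matrix γ β ℂ} (hM : ‖M‖ ≤ 1) :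
    SchmidtBounded (ψ * Mᵀ) Λ R := by
  have := (h.transpose.mul_left hM).transpose
  rwa [Matrix.transpose_mul, Matrix.transpose_transpose] at this

/-- Selecting rows along an injection is multiplication by the adjoint of an isometry. -/
theorem submatrix_left [DecidableEq γ] (h : SchmidtBounded ψ Λ R) {f : γ → α} (hf : Function.Injective f) :
    SchmidtBounded (ψ.submatrix f id) Λ R := by
  have h1 : ψ.submatrix f id = (1 : Matrix α α ℂ).submatrix f id * ψ := by
    ext i j
    simp [Matrix.mul_apply, Matrix.one_apply]
  rw [h1]
  refine h.mul_left ?_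
  rw [← Matrix.l2_opNorm_conjTranspose]
  refine opNorm_le_one_of_conjTranspose_mul_self ?_
  ext i j
  simp [Matrix.mul_apply, Matrix.one_apply, hf.eq_iff, eq_comm]

end SchmidtBounded

theorem rank_add_le {α β : Type} [Fintype α] [Fintype β] (A B : Matrix α β ℂ) :
    (A + B).rank ≤ A.rank + B.rank := by
  unfold Matrix.rank
  rw [Matrix.mulVecLin_add]
  exact (Submodule.finrank_mono (LinearMap.range_add_le _ _)).trans
    (Submodule.finrank_add_le_finrank_add_finrank _ _)

theorem rank_sum_le {ι α β : Type} [Fintype α] [Fintype β] (S : Finset ι)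
    (A : ι → Matrix α β ℂ) : (∑ x ∈ S, A x).rank ≤ ∑ x ∈ S, (A x).rank := by
  classical
  induction S using Finset.induction_on with
  | empty => simp
  | insert x S hx ih =>
    rw [Finset.sum_insert hx, Finset.sum_insert hx]
    exact (rank_add_le _ _).trans (by gcongr)

/-- Merging the blocks `ψ x` into one matrix, side by side. -/
theorem SchmidtBounded.of_blocks {α β γ δ : Type} [Fintype α] [Fintype β] [Fintype γ] [Fintype δ]
    [DecidableEq α] [DecidableEq β] [DecidableEq γ] [DecidableEq δ] (e : γ ≃ δ × β)
    (ψ : δ → Matrix α β ℂ) {Λ R : ℝ} (hψ : ∀ x, SchmidtBounded (ψ x) Λ R) :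
    SchmidtBounded (Matrix.of fun i t => ψ (e t).1 i (e t).2)
      (Fintype.card δ * Λ) (Fintype.card δ * R) := by
  set φ : Matrix α γ ℂ := Matrix.of fun i t => ψ (e t).1 i (e t).2 with hφ
  constructor
  -- Placing blocks side by side adds the reduced density matrices, so the largest eigenvalue is
  -- subadditive.
  · have h1 : φ * φᴴ = ∑ x, ψ x * (ψ x)ᴴ := by
      ext i j
      rw [Matrix.sum_apply, Matrix.mul_apply]
      simp only [Matrix.mul_apply, Matrix.conjTranspose_apply, hφ, Matrix.of_apply]
      rw [Equiv.sum_comp e (fun y => ψ y.1 i y.2 * star (ψ y.1 j y.2)), Fintype.sum_prod_type]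
    have h2 : ∀ {κ : Type} [Fintype κ] [DecidableEq κ] (A : Matrix α κ ℂ),
        ‖A * Aᴴ‖ = ‖A‖ ^ 2 := by
      intro κ _ _ A
      have := Matrix.l2_opNorm_conjTranspose_mul_self Aᴴ
      rw [Matrix.conjTranspose_conjTranspose, Matrix.l2_opNorm_conjTranspose] at this
      rw [this, sq]
    rw [← h2, h1]
    refine (norm_sum_le _ _).trans ?_
    calc ∑ x, ‖ψ x * (ψ x)ᴴ‖ ≤ ∑ _x : δ, Λ :=
          Finset.sum_le_sum fun x _ => by rw [h2]; exact (hψ x).1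
      _ = Fintype.card δ * Λ := by simp
  -- `S x` embeds the columns of the block `x` at their place, which exhibits `φ` as a sum of
  -- matrices of rank at most `R`.
  · let S : δ → Matrix β γ ℂ := fun x => Matrix.of fun j t => if e t = (x, j) then 1 else 0
    have h1 : φ = ∑ x, ψ x * S x := by
      ext i t
      rw [Matrix.sum_apply]
      simp only [S, Matrix.mul_apply, Matrix.of_apply, hφ, mul_ite, mul_one, mul_zero]
      rw [← Fintype.sum_prod_type' (f := fun x j => if e t = (x, j) then ψ x i j else 0)]
      simp
    have h2 : (∑ x, ψ x * S x).rank ≤ ∑ x, (ψ x).rank :=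
      (rank_sum_le Finset.univ fun x => ψ x * S x).trans
        (Finset.sum_le_sum fun x _ => Matrix.rank_mul_le_left (ψ x) (S x))
    rw [h1]
    calc ((∑ x, ψ x * S x).rank : ℝ)
        ≤ ∑ x, ((ψ x).rank : ℝ) := by exact_mod_cast h2
      _ ≤ ∑ _x : δ, R := Finset.sum_le_sum fun x _ => (hψ x).2
      _ = Fintype.card δ * R := by simp

theorem SchmidtBounded.sendToBob {p d q : ℕ} {ψ : Matrix (Fin p × Fin d) (Fin q) ℂ} {Λ R : ℝ}
    (h : SchmidtBounded ψ Λ R) : SchmidtBounded (sendToBob ψ) (d * Λ) (d * R) := by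
  have := SchmidtBounded.of_blocks finProdFinEquiv.symm
    (fun x : Fin d => ψ.submatrix (fun i => (i, x)) id)
    (fun x => h.submatrix_left fun i j hij => (Prod.mk.inj hij).1)
  rw [Fintype.card_fin] at this
  exact this

theorem SchmidtBounded.sendToAlice {p d q : ℕ} {ψ : Matrix (Fin p) (Fin d × Fin q) ℂ} {Λ R : ℝ}
    (h : SchmidtBounded ψ Λ R) : SchmidtBounded (sendToAlice ψ) (d * Λ) (d * R) := by
  have := (SchmidtBounded.of_blocks (finProdFinEquiv.symm.trans (Equiv.prodComm (Fin p) (Fin d)))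
    (fun x : Fin d => ψᵀ.submatrix (fun i : Fin q => (x, i)) id)
    (fun x => h.transpose.submatrix_left fun i j hij => (Prod.mk.inj hij).2)).transpose
  rw [Fintype.card_fin] at this
  exact this

theorem frobSq_sendToBob {p d q : ℕ} (ψ : Matrix (Fin p × Fin d) (Fin q) ℂ) :
    frobSq (sendToBob ψ) = frobSq ψ := by
  unfold frobSq sendToBob
  rw [Fintype.sum_prod_type]
  refine Finset.sum_congr rfl fun i _ => ?_
  simp only [Matrix.of_apply]
  rw [Equiv.sum_comp finProdFinEquiv.symm (fun t : Fin d × Fin q => ‖ψ (i, t.1) t.2‖ ^ 2),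
    Fintype.sum_prod_type]

theorem frobSq_sendToAlice {p d q : ℕ} (ψ : Matrix (Fin p) (Fin d × Fin q) ℂ) :
    frobSq (sendToAlice ψ) = frobSq ψ := by
  unfold frobSq sendToAlice
  simp only [Matrix.of_apply]
  rw [Equiv.sum_comp finProdFinEquiv.symm
    (fun t : Fin p × Fin d => ∑ j, ‖ψ t.1 (t.2, j)‖ ^ 2), Fintype.sum_prod_type]
  simp only [Fintype.sum_prod_type]

/-! ### Protocols -/

theorem QuantumProtocol.posSemidef_output {n p q : ℕ} (P : QuantumProtocol n p q)
    (ψ : Matrix (Fin p) (Fin q) ℂ) : (P.output ψ).PosSemidef := by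
  induction P with
  | finish U hU V hV => exact posSemidef_discard _
  | alice d U hU next ih => exact ih _
  | bob d V hV next ih => exact ih _

theorem ClassicalProtocol.posSemidef_output {n p q : ℕ} (P : ClassicalProtocol n p q)
    (ψ : Matrix (Fin p) (Fin q) ℂ) : (P.output ψ).PosSemidef := by
  induction P with
  | finish U hU V hV => exact posSemidef_discard _
  | alice d M hM next ih => exact Matrix.posSemidef_sum _ fun x _ => ih x _
  | bob d M hM next ih => exact Matrix.posSemidef_sum _ fun x _ => ih x _

theorem logb_two_natCast_nonneg (d : ℕ) : 0 ≤ Real.logb 2 d :=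
  div_nonneg (Real.log_natCast_nonneg d) (Real.log_nonneg one_le_two)

theorem QuantumProtocol.cost_nonneg {n p q : ℕ} (P : QuantumProtocol n p q) : 0 ≤ P.cost := by
  induction P with
  | finish U hU V hV => exact le_rfl
  | alice d U hU next ih => exact add_nonneg (logb_two_natCast_nonneg d) ih
  | bob d V hV next ih => exact add_nonneg (logb_two_natCast_nonneg d) ih

theorem ClassicalProtocol.cost_nonneg {n p q : ℕ} (P : ClassicalProtocol n p q) : 0 ≤ P.cost := by
  induction P with
  | finish U hU V hV => exact le_rfl
  | alice d M hM next ih =>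
    exact add_nonneg (logb_two_natCast_nonneg d) (Real.iSup_nonneg fun x => ih x)
  | bob d M hM next ih =>
    exact add_nonneg (logb_two_natCast_nonneg d) (Real.iSup_nonneg fun x => ih x)

theorem frobSq_residual_eq_zero {n : ℕ} {κ l : Type} [Fintype κ] [Fintype l]
    {ψ : Matrix (Fin n × κ) (Fin n × l) ℂ} (h : frobSq ψ = 0) : frobSq (residual ψ) = 0 := by
  have h0 : ∀ x y, ψ x y = 0 := by
    intro x y
    have h1 := (Finset.sum_eq_zero_iff_of_nonneg
      (fun _ _ => Finset.sum_nonneg fun _ _ => by positivity)).1 h x (Finset.mem_univ x)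
    have h2 := (Finset.sum_eq_zero_iff_of_nonneg (fun _ _ => by positivity)).1 h1 y
      (Finset.mem_univ y)
    simpa using h2
  simp [frobSq, residual, Matrix.sum_apply, h0]

theorem overlap_local_isometries {n p q a b : ℕ} (hn : 1 ≤ n)
    {U : Matrix (Fin n × Fin a) (Fin p) ℂ} (hU : Uᴴ * U = 1)
    {V : Matrix (Fin n × Fin b) (Fin q) ℂ} (hV : Vᴴ * V = 1) {ψ : Matrix (Fin p) (Fin q) ℂ}
    {Λ R : ℝ} (h : SchmidtBounded ψ Λ R) (hp : frobSq ψ ≤ Λ * R) :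
    (2 * overlap (embezzlingState n) (discard (U * ψ * Vᵀ)) - frobSq ψ) * harmonicSum n ≤
      frobSq ψ * (5 + 4 * Real.log (harmonicSum n) + Real.log (Λ * R / frobSq ψ)) := by
  have hf : frobSq (U * ψ * Vᵀ) = frobSq ψ := by
    rw [frobSq_mul_isometry_transpose hV, frobSq_isometry_mul hU]
  have hb := (h.mul_left (opNorm_le_one_of_conjTranspose_mul_self hU)).mul_transpose
    (opNorm_le_one_of_conjTranspose_mul_self hV)
  rw [overlap_embezzlingState_discard, ← hf]
  rcases (frobSq_nonneg (U * ψ * Vᵀ)).eq_or_lt with h0 | h0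
  · rw [frobSq_residual_eq_zero h0.symm, ← h0]
    simp
  · exact residual_bound hn _ h0 hb.2 hb.1 (hf ▸ hp)

/-- The induction step for one quantum message: `Λ R` grows by `d ^ 2`, and `log (d ^ 2)` is exactly
the cost term `2 * log 2 * logb 2 d`. -/
theorem bound_after_sending {H F p Λ R C : ℝ} {d : ℕ} (hp0 : 0 ≤ p) (hp : p ≤ Λ * R)
    (ih : p ≤ d * Λ * (d * R) → (2 * F - p) * H ≤
      p * (5 + 4 * Real.log H + 2 * Real.log 2 * C + Real.log (d * Λ * (d * R) / p)))
    (hd : d = 0 → p = 0) :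
    (2 * F - p) * H ≤
      p * (5 + 4 * Real.log H + 2 * Real.log 2 * (Real.logb 2 d + C) + Real.log (Λ * R / p)) := by
  rcases hp0.eq_or_lt with rfl | hp0
  · have := ih (by nlinarith [mul_nonneg (Nat.cast_nonneg (α := ℝ) d) (Nat.cast_nonneg (α := ℝ) d)])
    simpa using this
  have hd1 : 1 ≤ d := Nat.one_le_iff_ne_zero.2 fun h => hp0.ne' (hd h)
  have hd2 : (1 : ℝ) ≤ d := by exact_mod_cast hd1
  have hΛR : 0 < Λ * R := hp0.trans_le hp
  have e : (d : ℝ) * Λ * (d * R) = (d : ℝ) ^ 2 * (Λ * R) := by ring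
  rw [e] at ih
  refine (ih (by nlinarith [one_le_pow₀ hd2 (n := 2)])).trans (le_of_eq ?_)
  rw [mul_div_assoc, Real.log_mul (by positivity) (by positivity), Real.log_pow, mul_add
    (2 * Real.log 2), Real.logb]
  have : Real.log 2 ≠ 0 := by positivity
  field_simp
  push_cast
  ring

theorem QuantumProtocol.overlap_bound {n p q : ℕ} (hn : 1 ≤ n) (P : QuantumProtocol n p q)
    (ψ : Matrix (Fin p) (Fin q) ℂ) {Λ R : ℝ} (h : SchmidtBounded ψ Λ R)
    (hp : frobSq ψ ≤ Λ * R) :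
    (2 * overlap (embezzlingState n) (P.output ψ) - frobSq ψ) * harmonicSum n ≤
      frobSq ψ * (5 + 4 * Real.log (harmonicSum n) + 2 * Real.log 2 * P.cost +
        Real.log (Λ * R / frobSq ψ)) := by
  -- Each transfer changes the Schmidt bounds, so the induction hypothesis must allow new `Λ` and
  -- `R`.
  induction P generalizing Λ R with
  | finish U hU V hV =>
    simpa [QuantumProtocol.output, QuantumProtocol.cost] using overlap_local_isometries hn hU hV h hp
  | alice d U hU next ih =>
    have hf : frobSq (sendToBob (U * ψ)) = frobSq ψ := by
      rw [frobSq_sendToBob, frobSq_isometry_mul hU]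
    refine bound_after_sending (frobSq_nonneg ψ) hp (fun hp' => ?_) ?_
    · have := ih _ (h.mul_left (opNorm_le_one_of_conjTranspose_mul_self hU)).sendToBob (hf ▸ hp')
      rwa [hf] at this
    · rintro rfl
      rw [← frobSq_isometry_mul hU]
      simp [frobSq]
  | bob d V hV next ih =>
    have hf : frobSq (sendToAlice (ψ * Vᵀ)) = frobSq ψ := by
      rw [frobSq_sendToAlice, frobSq_mul_isometry_transpose hV]
    refine bound_after_sending (frobSq_nonneg ψ) hp (fun hp' => ?_) ?_
    · have := ih _ (h.mul_transpose (opNorm_le_one_of_conjTranspose_mul_self hV)).sendToAlice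
        (hf ▸ hp')
      rwa [hf] at this
    · rintro rfl
      rw [← frobSq_mul_isometry_transpose hV]
      simp [frobSq]

/-- The entropy of `d` outcomes is at most `log d`: expand around the uniform value `p / d` and use
`log y ≤ y - 1`; the errors `p / d - r x` sum to zero. -/
theorem sum_mul_log_div_le {d : ℕ} {r : Fin d → ℝ} (hr : ∀ x, 0 ≤ r x) {p L : ℝ} (hp : 0 < p)
    (hL : 0 < L) (hsum : ∑ x, r x = p) :
    ∑ x, r x * Real.log (L / r x) ≤ p * (Real.log d + Real.log (L / p)) := by
  have hd : 0 < d := by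
    rcases Nat.eq_zero_or_pos d with rfl | h
    · simp at hsum; linarith
    · exact h
  have hd' : (0 : ℝ) < d := by exact_mod_cast hd
  have hx : ∀ x, r x * Real.log (L / r x) ≤
      r x * (Real.log d + Real.log (L / p)) + (p / d - r x) := by
    intro x
    rcases (hr x).eq_or_lt with h | h
    · rw [← h]
      have : 0 ≤ p / d := by positivity
      simpa using this
    · have h1 : Real.log (L / r x) = Real.log d + Real.log (L / p) + Real.log (p / (d * r x)) := by
        rw [← Real.log_mul (by positivity) (by positivity),
          ← Real.log_mul (by positivity) (by positivity)]
        congr 1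
        field_simp
      have h2 : Real.log (p / (d * r x)) ≤ p / (d * r x) - 1 :=
        Real.log_le_sub_one_of_pos (by positivity)
      have h3 : r x * (p / (d * r x) - 1) = p / d - r x := by field_simp
      rw [h1, mul_add, ← h3]
      gcongr
  refine (Finset.sum_le_sum fun x _ => hx x).trans (le_of_eq ?_)
  rw [Finset.sum_add_distrib, ← Finset.sum_mul, hsum, Finset.sum_sub_distrib, hsum]
  simp
  field_simp
  ring

/-- The induction step for one classical message, with `r x` the branch weights and `L = Λ R` the
same in all branches. The only loss is the entropy of the outcome, at most `log d` per unit weight.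
-/
theorem bound_after_measurement {H p L : ℝ} {d : ℕ} {F r c : Fin d → ℝ}
    (hr : ∀ x, 0 ≤ r x) (hsum : ∑ x, r x = p) (hp : p ≤ L)
    (ih : ∀ x, r x ≤ L → (2 * F x - r x) * H ≤
      r x * (5 + 4 * Real.log H + Real.log 2 * c x + Real.log (L / r x))) :
    (2 * ∑ x, F x - p) * H ≤ p * (5 + 4 * Real.log H +
      Real.log 2 * (Real.logb 2 d + ⨆ x, c x) + Real.log (L / p)) := by
  have hle : ∀ x, r x ≤ p := fun x => hsum ▸
    Finset.single_le_sum (fun y _ => hr y) (Finset.mem_univ x)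
  have hp0 : 0 ≤ p := hsum ▸ Finset.sum_nonneg fun x _ => hr x
  have hlog2 : 0 < Real.log 2 := Real.log_pos one_lt_two
  have h1 : (2 * ∑ x, F x - p) * H = ∑ x, (2 * F x - r x) * H := by
    rw [← Finset.sum_mul, Finset.sum_sub_distrib, hsum, Finset.mul_sum]
  rw [h1]
  -- For total weight `0` every branch weight is `0`, and the branch bounds already give nonpositive
  -- summands.
  rcases hp0.eq_or_lt with h0 | h0
  · rw [← h0, zero_mul]
    refine Finset.sum_nonpos fun x _ => ?_
    have hx : r x = 0 := le_antisymm (h0 ▸ hle x) (hr x)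
    have := ih x ((hle x).trans hp)
    simpa [hx] using this
  calc ∑ x, (2 * F x - r x) * H
      ≤ ∑ x, (r x * (5 + 4 * Real.log H + Real.log 2 * ⨆ y, c y) +
          r x * Real.log (L / r x)) := by
        refine Finset.sum_le_sum fun x _ => (ih x ((hle x).trans hp)).trans ?_
        rw [← mul_add]
        have : c x ≤ ⨆ y, c y := le_ciSup (Set.finite_range c).bddAbove x
        have := hr x
        gcongr
    _ ≤ p * (5 + 4 * Real.log H + Real.log 2 * ⨆ y, c y) +
          p * (Real.log d + Real.log (L / p)) := by
        rw [Finset.sum_add_distrib, ← Finset.sum_mul, hsum]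
        gcongr
        exact sum_mul_log_div_le hr h0 (h0.trans_le hp) hsum
    _ = _ := by
        rw [Real.logb, mul_add (Real.log 2), mul_div_cancel₀ _ hlog2.ne']
        ring

theorem ClassicalProtocol.overlap_bound {n p q : ℕ} (hn : 1 ≤ n) (P : ClassicalProtocol n p q)
    (ψ : Matrix (Fin p) (Fin q) ℂ) {Λ R : ℝ} (h : SchmidtBounded ψ Λ R)
    (hp : frobSq ψ ≤ Λ * R) :
    (2 * overlap (embezzlingState n) (P.output ψ) - frobSq ψ) * harmonicSum n ≤
      frobSq ψ * (5 + 4 * Real.log (harmonicSum n) + Real.log 2 * P.cost +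
        Real.log (Λ * R / frobSq ψ)) := by
  induction P with
  | finish U hU V hV =>
    simpa [ClassicalProtocol.output, ClassicalProtocol.cost] using
      overlap_local_isometries hn hU hV h hp
  | alice d M hM next ih =>
    rw [ClassicalProtocol.output, overlap_sum]
    exact bound_after_measurement (fun x => frobSq_nonneg _) (sum_frobSq_mul hM ψ) hp
      fun x hx => ih x _ (h.mul_left (opNorm_kraus_le_one hM x)) hx
  | bob d M hM next ih =>
    rw [ClassicalProtocol.output, overlap_sum]
    exact bound_after_measurement (fun x => frobSq_nonneg _) (sum_frobSq_mul_transpose hM ψ) hp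
      fun x hx => ih x _ (h.mul_transpose (opNorm_kraus_le_one hM x)) hx

/-! ### EPR pairs -/

theorem eprPairs_eq_smul_one (m : ℕ) :
    eprPairs m = (((1 / Real.sqrt 2) ^ m : ℝ) : ℂ) • (1 : Matrix _ _ ℂ) := by
  ext i j
  rw [eprPairs, Matrix.of_apply, Matrix.smul_apply, Matrix.one_apply]
  by_cases h : i = j
  · subst h
    simp [eprPair]
  · rw [if_neg h, smul_zero]
    have : finFunctionFinEquiv.symm i ≠ finFunctionFinEquiv.symm j := by simpa using h
    obtain ⟨k, hk⟩ := Function.ne_iff.1 this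
    exact Finset.prod_eq_zero (Finset.mem_univ k) (by rw [eprPair, Matrix.of_apply, if_neg hk])

theorem epr_amplitude_sq (m : ℕ) : ((1 / Real.sqrt 2) ^ m) ^ 2 = (1 / 2 : ℝ) ^ m := by
  rw [← pow_mul, mul_comm, pow_mul, div_pow, Real.sq_sqrt zero_le_two, one_pow]

theorem frobSq_eprPairs (m : ℕ) : frobSq (eprPairs m) = 1 := by
  have h : ∀ i, ∑ j, ‖eprPairs m i j‖ ^ 2 = (1 / 2 : ℝ) ^ m := by
    intro i
    rw [Finset.sum_eq_single i, eprPairs_eq_smul_one]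
    · rw [Matrix.smul_apply, Matrix.one_apply_eq, smul_eq_mul, mul_one, Complex.norm_real,
        Real.norm_eq_abs, sq_abs, epr_amplitude_sq]
    · intro j _ hj
      simp [eprPairs_eq_smul_one, Matrix.one_apply_ne hj.symm]
    · simp
  rw [frobSq, Finset.sum_congr rfl fun i _ => h i]
  simp

/-- The two bounds multiply to `1` for every `m`, so the number of EPR pairs disappears from the
cost bounds. -/
theorem schmidtBounded_eprPairs (m : ℕ) :
    SchmidtBounded (eprPairs m) ((1 / 2 : ℝ) ^ m) (2 ^ m) := by
  constructor
  · rw [eprPairs_eq_smul_one, norm_smul, mul_pow, Complex.norm_real, Real.norm_eq_abs, sq_abs,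
      epr_amplitude_sq]
    refine mul_le_of_le_one_right (by positivity) (pow_le_one₀ (norm_nonneg _) ?_)
    exact opNorm_le_one_of_conjTranspose_mul_self (by simp)
  · have := Matrix.rank_le_width (eprPairs m)
    exact_mod_cast this

theorem QuantumProtocol.cost_bound {n m : ℕ} (hn : 1 ≤ n) {ε : ℝ}
    (P : QuantumProtocol n (2 ^ m) (2 ^ m))
    (h : 1 - ε ≤ fidelity (density (embezzlingState n)) (P.output (eprPairs m))) :
    (1 - 2 * ε) * harmonicSum n ≤
      5 + 4 * Real.log (harmonicSum n) + Real.log 2 * (2 * P.cost) := by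
  have hH := one_le_harmonicSum hn
  rw [fidelity_density (frobSq_embezzlingState hn) (P.posSemidef_output _)] at h
  have e : (1 / 2 : ℝ) ^ m * 2 ^ m = 1 := by rw [← mul_pow]; norm_num
  have := P.overlap_bound hn (eprPairs m) (schmidtBounded_eprPairs m)
    (by rw [frobSq_eprPairs, e])
  rw [frobSq_eprPairs, e, div_one, Real.log_one] at this
  nlinarith

theorem ClassicalProtocol.cost_bound {n m : ℕ} (hn : 1 ≤ n) {ε : ℝ}
    (P : ClassicalProtocol n (2 ^ m) (2 ^ m))
    (h : 1 - ε ≤ fidelity (density (embezzlingState n)) (P.output (eprPairs m))) :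
    (1 - 2 * ε) * harmonicSum n ≤ 5 + 4 * Real.log (harmonicSum n) + Real.log 2 * P.cost := by
  have hH := one_le_harmonicSum hn
  rw [fidelity_density (frobSq_embezzlingState hn) (P.posSemidef_output _)] at h
  have e : (1 / 2 : ℝ) ^ m * 2 ^ m = 1 := by rw [← mul_pow]; norm_num
  have := P.overlap_bound hn (eprPairs m) (schmidtBounded_eprPairs m)
    (by rw [frobSq_eprPairs, e])
  rw [frobSq_eprPairs, e, div_one, Real.log_one] at this
  nlinarith

end Protocols

/-! ### The spectral bound -/

theorem log_eq_mul_logb (x : ℝ) : Real.log x = Real.log 2 * Real.logb 2 x :=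
  (mul_div_cancel₀ _ (Real.log_pos one_lt_two).ne').symm

theorem harmonicSum_le_two_mul_logb {n : ℕ} (hn : 1 ≤ n) :
    harmonicSum n ≤ 2 * Real.logb 2 ((n : ℝ) + 1) := by
  have h2 : 0 < Real.log 2 := Real.log_pos one_lt_two
  have h2' : Real.log 2 < 1 := by linarith [Real.log_two_lt_d9]
  have hn' : (1 : ℝ) ≤ n := by exact_mod_cast hn
  have h3 : Real.log n ≤ Real.log (n + 1) := Real.log_le_log (by linarith) (by linarith)
  have h4 : Real.log 2 ≤ Real.log (n + 1) := Real.log_le_log (by norm_num) (by linarith)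
  have h5 := harmonicSum_le n
  have h6 : 1 ≤ Real.logb 2 ((n : ℝ) + 1) := by
    rw [Real.logb, one_le_div h2]; exact h4
  have h7 := log_eq_mul_logb ((n : ℝ) + 1)
  nlinarith

/-- The elements up to `N` form a window of ratio `N / j`; the larger ones are at most `N` terms,
each at most `1 / N`. -/
theorem sum_inv_le_of_card_le {S : Finset ℕ} {j N : ℕ} (hj : 1 ≤ j) (hS : ∀ i ∈ S, j ≤ i)
    (hN : S.card ≤ N) (hjN : j ≤ N) :
    ∑ i ∈ S, 1 / (i : ℝ) ≤ 2 + Real.log ((N : ℝ) / j) := by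
  have hj' : (1 : ℝ) ≤ j := by exact_mod_cast hj
  have hN' : (1 : ℝ) ≤ N := by exact_mod_cast hj.trans hjN
  rw [← Finset.sum_filter_add_sum_filter_not S (fun i => i ≤ N)]
  have h1 : ∑ i ∈ S with i ≤ N, 1 / (i : ℝ) ≤ 1 + Real.log ((N : ℝ) / j) := by
    refine sum_inv_le_of_mem_window (by linarith) (by exact_mod_cast hjN) fun i hi => ?_
    obtain ⟨hi1, hi2⟩ := Finset.mem_filter.1 hi
    exact ⟨by exact_mod_cast hS i hi1, by exact_mod_cast hi2⟩
  have h2 : ∑ i ∈ S with ¬ i ≤ N, 1 / (i : ℝ) ≤ 1 := by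
    calc ∑ i ∈ S with ¬ i ≤ N, 1 / (i : ℝ) ≤ ∑ i ∈ S with ¬ i ≤ N, 1 / (N : ℝ) := by
          refine Finset.sum_le_sum fun i hi => ?_
          have : (N : ℝ) ≤ i := by exact_mod_cast (not_le.1 (Finset.mem_filter.1 hi).2).le
          exact one_div_le_one_div_of_le (by linarith) this
      _ = (S.filter fun i => ¬ i ≤ N).card * (1 / (N : ℝ)) := by simp
      _ ≤ N * (1 / (N : ℝ)) := by
          gcongr
          exact (Finset.card_filter_le _ _).trans hN
      _ = 1 := by field_simp
  linarith

theorem log_card_div_min_ge {n : ℕ} {S : Finset ℕ} (hne : S.Nonempty)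
    (hS : ∀ i ∈ S, 1 ≤ i ∧ i ≤ n) {δ : ℝ} (hδ : 0 ≤ δ) (hδ1 : δ < 1)
    (hsum : (1 - δ) * harmonicSum n ≤ ∑ i ∈ S, 1 / (i : ℝ)) :
    (1 - 2 * δ) * Real.log n - 2 ≤ Real.log ((S.card : ℝ) / (S.min' hne : ℕ)) := by
  set j := S.min' hne
  obtain ⟨hj1, hjn⟩ := hS j (S.min'_mem hne)
  have hj : (1 : ℝ) ≤ j := by exact_mod_cast hj1
  have hn : (1 : ℝ) ≤ n := by exact_mod_cast hj1.trans hjn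
  have hlog : 0 ≤ Real.log n := Real.log_nonneg hn
  have hH : Real.log n ≤ harmonicSum n :=
    (Real.log_le_log (by linarith) (by linarith)).trans (log_add_one_le_harmonicSum n)
  have h1 : (1 - δ) * Real.log n ≤ ∑ i ∈ S, 1 / (i : ℝ) :=
    (mul_le_mul_of_nonneg_left hH (by linarith)).trans hsum
  have hmin : ∀ i ∈ S, j ≤ i := fun i hi => S.min'_le i hi
  rcases le_or_gt j S.card with hc | hc
  · have := sum_inv_le_of_card_le hj1 hmin le_rfl hc
    nlinarith
  -- If `S` has fewer than `j` elements its weight is at most `1`, so `(1 - δ) log n ≤ 1`.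
  -- Subtracting `log n` from twice this gives `(1 - 2δ) log n - 2 ≤ -log n`, and the ratio is at
  -- least `1 / n`. This case uses the `2δ`; the other gives `1 - δ`.
  · have h2 : ∑ i ∈ S, 1 / (i : ℝ) ≤ 1 := by
      calc ∑ i ∈ S, 1 / (i : ℝ) ≤ ∑ i ∈ S, 1 / (j : ℝ) := by
            refine Finset.sum_le_sum fun i hi => ?_
            have : (j : ℝ) ≤ i := by exact_mod_cast hmin i hi
            exact one_div_le_one_div_of_le (by linarith) this
        _ = S.card * (1 / (j : ℝ)) := by simp
        _ ≤ j * (1 / (j : ℝ)) := by gcongr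
        _ = 1 := by field_simp
    have h3 : -Real.log n ≤ Real.log ((S.card : ℝ) / j) := by
      rw [← Real.log_inv]
      refine Real.log_le_log (by positivity) ?_
      have h4 : (1 : ℝ) ≤ S.card := by exact_mod_cast hne.card_pos
      have h5 : (j : ℝ) ≤ n := by exact_mod_cast hjn
      rw [inv_eq_one_div]
      exact div_le_div₀ (by linarith) h4 (by linarith) h5
    linarith

theorem spectralDelta_ge {ι : Type} [Fintype ι] [Nonempty ι] {r : ι → ℝ} {δ B : ℝ}
    (hδ : 0 ≤ δ) (hr : 1 ≤ ∑ i, r i)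
    (h : ∀ (J : Finset ι) (hJ : J.Nonempty), 1 - δ ≤ ∑ j ∈ J, r j →
      ((2 : ℝ) ^ B) ≤ J.card * J.sup' hJ r) : B ≤ spectralDelta r δ := by
  have h1 : (2 : ℝ) ^ B ≤ sInf {x : ℝ | ∃ (J : Finset ι) (hJ : J.Nonempty),
      1 - δ ≤ ∑ j ∈ J, r j ∧ x = (J.card : ℝ) * J.sup' hJ r} := by
    refine le_csInf ⟨_, Finset.univ, Finset.univ_nonempty, by linarith, rfl⟩ ?_
    rintro x ⟨J, hJ, hs, rfl⟩
    exact h J hJ hs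
  rw [spectralDelta, Real.le_logb_iff_rpow_le one_lt_two (lt_of_lt_of_le (by positivity) h1)]
  exact h1

/-! ### The spectrum of the reduced state -/

theorem traceBob_density_embezzlingState (n : ℕ) :
    traceBob (density (embezzlingState n)) =
      Matrix.diagonal fun i => ((amplitude n i ^ 2 : ℝ) : ℂ) := by
  ext i i'
  rw [traceBob, Matrix.of_apply, Finset.sum_eq_single i]
  · by_cases h : i = i'
    · subst h
      simp [density, embezzlingState, amplitude, sq]
    · simp [density, embezzlingState, h, Ne.symm h]
  · intro j _ hj
    simp [density, embezzlingState, hj.symm]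
  · simp

theorem amplitude_sq_injective {n : ℕ} (hn : 1 ≤ n) :
    Function.Injective fun i => amplitude n i ^ 2 := by
  have hH := one_le_harmonicSum hn
  intro i j hij
  simp only [amplitude_sq hn] at hij
  rw [div_left_inj' (by linarith), one_div, one_div, inv_inj] at hij
  exact Fin.ext (by exact_mod_cast add_right_cancel hij)

/-- `eigenvalues` need not follow the order of the diagonal, so both lists are compared as multisets
of roots of the characteristic polynomial; distinctness of the entries makes the matching injective.
-/
theorem exists_injective_eigenvalues_eq {ι : Type} [Fintype ι] [DecidableEq ι] {w : ι → ℝ}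
    (hw : Function.Injective w) {A : Matrix ι ι ℂ} (hA : A.IsHermitian)
    (h : A = Matrix.diagonal fun i => (w i : ℂ)) :
    ∃ σ : ι → ι, Function.Injective σ ∧ ∀ i, hA.eigenvalues i = w (σ i) := by
  have h1 := hA.roots_charpoly_eq_eigenvalues
  have h2 : A.charpoly.roots = Multiset.map (fun i => (w i : ℂ)) Finset.univ.val := by
    rw [h, Matrix.charpoly_diagonal, Polynomial.roots_prod]
    · simp
    · simp [Finset.prod_ne_zero_iff, Polynomial.X_sub_C_ne_zero]
  have h3 : Multiset.map hA.eigenvalues Finset.univ.val = Multiset.map w Finset.univ.val := by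
    refine Multiset.map_injective Complex.ofReal_injective ?_
    rw [Multiset.map_map, Multiset.map_map]
    exact h1.symm.trans h2
  have h4 : ∀ i, ∃ j, hA.eigenvalues i = w j := by
    intro i
    have : hA.eigenvalues i ∈ Multiset.map w Finset.univ.val :=
      h3 ▸ Multiset.mem_map_of_mem _ (Finset.mem_univ_val i)
    obtain ⟨j, -, hj⟩ := Multiset.mem_map.1 this
    exact ⟨j, hj.symm⟩
  choose σ hσ using h4
  refine ⟨σ, fun i j hij => ?_, hσ⟩
  have h5 : (Multiset.map hA.eigenvalues Finset.univ.val).Nodup := by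
    rw [h3]; exact Finset.univ.nodup.map hw
  exact Multiset.inj_on_of_nodup_map h5 i (Finset.mem_univ_val i) j (Finset.mem_univ_val j)
    (by rw [hσ, hσ, hij])

theorem robustDelta_embezzlingState_ge {n : ℕ} (hn : 1 ≤ n) {δ : ℝ} (hδ : 0 ≤ δ) (hδ1 : δ < 1) :
    (1 - 2 * δ) * Real.logb 2 n - 4 - Real.logb 2 (Real.logb 2 ((n : ℝ) + 1)) ≤
      robustDelta (traceBob_density_isHermitian (embezzlingState n)) δ := by
  have hH := one_le_harmonicSum hn
  have hHl := harmonicSum_le_two_mul_logb hn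
  have : Nonempty (Fin n) := ⟨⟨0, hn⟩⟩
  obtain ⟨σ, hσ, hev⟩ := exists_injective_eigenvalues_eq (amplitude_sq_injective hn)
    (traceBob_density_isHermitian (embezzlingState n)) (traceBob_density_embezzlingState n)
  have hev' : (traceBob_density_isHermitian (embezzlingState n)).eigenvalues =
    fun i => amplitude n (σ i) ^ 2 := funext hev
  rw [robustDelta, hev']
  refine spectralDelta_ge hδ ?_ fun J hJ hs => ?_
  · rw [Function.Bijective.sum_comp (Finite.injective_iff_bijective.1 hσ)
      (fun i => amplitude n i ^ 2), sum_amplitude_sq hn]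
  let g : Fin n → ℕ := fun i => (σ i : ℕ) + 1
  have hg : Function.Injective g := fun i j hij => hσ (Fin.ext (Nat.succ_injective hij))
  set S := J.image g
  have hne : S.Nonempty := hJ.image g
  have hcard : S.card = J.card := Finset.card_image_of_injective J hg
  have hw : ∀ i, amplitude n (σ i) ^ 2 = 1 / (g i : ℝ) / harmonicSum n := fun i => by
    rw [amplitude_sq hn]
    simp [g]
  have hlog := log_card_div_min_ge (n := n) hne
    (fun i hi => by
      obtain ⟨k, -, rfl⟩ := Finset.mem_image.1 hi
      exact ⟨Nat.succ_pos _, (σ k).isLt⟩) hδ hδ1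
    (by
      rw [Finset.sum_image hg.injOn]
      simp only [hw] at hs
      rwa [← Finset.sum_div, le_div_iff₀ (by linarith)] at hs)
  obtain ⟨k, hk, hkmin⟩ := Finset.mem_image.1 (S.min'_mem hne)
  have hsup : 1 / ((S.min' hne : ℕ) : ℝ) / harmonicSum n ≤
      J.sup' hJ fun i => amplitude n (σ i) ^ 2 := by
    rw [← hkmin, ← hw]
    exact Finset.le_sup' (fun i => amplitude n (σ i) ^ 2) hk
  have hjpos : 0 < ((S.min' hne : ℕ) : ℝ) := by
    rw [← hkmin]; simp [g]; positivity
  have hSpos : 0 < (S.card : ℝ) := by exact_mod_cast hne.card_pos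
  refine le_trans ?_ (mul_le_mul_of_nonneg_left hsup (Nat.cast_nonneg _))
  rw [← hcard]
  have e : (S.card : ℝ) * (1 / ((S.min' hne : ℕ) : ℝ) / harmonicSum n) =
      ((S.card : ℝ) / (S.min' hne : ℕ)) / harmonicSum n := by
    field_simp
  have hl2 : 0 < Real.log 2 := Real.log_pos one_lt_two
  -- The final constant is `4 = 3 + 1`: the natural-log error `2` becomes at most `3` in base two,
  -- and `logb 2 H_n` exceeds the double logarithm by at most `1`.
  have hl2' : 2 / 3 ≤ Real.log 2 := by linarith [Real.log_two_gt_d9]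
  rw [e, ← Real.le_logb_iff_rpow_le one_lt_two (by positivity),
    Real.logb_div (by positivity) (by linarith)]
  have h1 : Real.logb 2 (harmonicSum n) ≤ 1 + Real.logb 2 (Real.logb 2 ((n : ℝ) + 1)) := by
    have h0 : 0 < Real.logb 2 ((n : ℝ) + 1) := by linarith
    calc Real.logb 2 (harmonicSum n) ≤ Real.logb 2 (2 * Real.logb 2 ((n : ℝ) + 1)) :=
          Real.logb_le_logb_of_le one_lt_two (by linarith) hHl
      _ = _ := by
          rw [Real.logb_mul two_ne_zero h0.ne', Real.logb_self_eq_one one_lt_two]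
  have h2 : (1 - 2 * δ) * Real.logb 2 n - 3 ≤
      Real.logb 2 ((S.card : ℝ) / (S.min' hne : ℕ)) := by
    rw [Real.logb, Real.logb, le_div_iff₀ hl2, sub_mul, mul_assoc, div_mul_cancel₀ _ hl2.ne']
    linarith
  linarith

/-! ### From overlaps to costs -/

/-- From `2 ^ 3 ≤ 3 ^ 2` and `2 ≤ (3 / 2) ^ 2`. This positive floor lets additive constants be
absorbed into multiples of the double logarithm. -/
theorem half_le_logb_logb {n : ℕ} (hn : 3 ≤ n) : 1 / 2 ≤ Real.logb 2 (Real.logb 2 n) := by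
  have hl2 : 0 < Real.log 2 := Real.log_pos one_lt_two
  have hn' : (3 : ℝ) ≤ n := by exact_mod_cast hn
  have h3 : 3 * Real.log 2 ≤ 2 * Real.log 3 := by
    have h : Real.log ((2 : ℝ) ^ 3) ≤ Real.log ((3 : ℝ) ^ 2) :=
      Real.log_le_log (by norm_num) (by norm_num)
    rw [Real.log_pow, Real.log_pow] at h
    exact_mod_cast h
  have h4 : 3 / 2 ≤ Real.logb 2 n := by
    rw [Real.logb, le_div_iff₀ hl2]
    have := Real.log_le_log (by norm_num) hn'
    linarith
  have h5 : Real.log 2 ≤ 2 * Real.log (3 / 2) := by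
    have h : Real.log (2 : ℝ) ≤ Real.log ((3 / 2 : ℝ) ^ 2) :=
      Real.log_le_log (by norm_num) (by norm_num)
    rw [Real.log_pow] at h
    exact_mod_cast h
  have h6 := Real.log_le_log (by norm_num) h4
  rw [Real.logb, le_div_iff₀ hl2]
  linarith

theorem le_rpow_of_le_one {x s : ℝ} (hx : 0 ≤ x) (hs : 0 < s) (hs1 : s ≤ 1) (h : x ^ s ≤ 1) :
    x ≤ x ^ s := by
  have hx1 : x ≤ 1 := by
    by_contra hc
    exact absurd h (not_le.2 (Real.one_lt_rpow (not_le.1 hc) hs))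
  rcases hx.eq_or_lt with rfl | hx
  · exact Real.rpow_nonneg le_rfl _
  · simpa using Real.rpow_le_rpow_of_exponent_ge hx hx1 hs1

theorem cost_ge_of_harmonic_bound {n : ℕ} (hn : 3 ≤ n) {ε C : ℝ} (hε : 0 ≤ ε) (hC : 0 ≤ C)
    (h : (1 - 2 * ε) * harmonicSum n ≤ 5 + 4 * Real.log (harmonicSum n) + Real.log 2 * C) :
    (1 - 2 * (4 * ε) ^ (1 / 8 : ℝ)) * Real.logb 2 n - 44 * Real.logb 2 (Real.logb 2 n) ≤ C := by
  have hl2 : 0 < Real.log 2 := Real.log_pos one_lt_two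
  have hl2' : Real.log 2 ≤ 1 := by linarith [Real.log_two_lt_d9]
  have hl2'' : 1 / 2 ≤ Real.log 2 := by linarith [Real.log_two_gt_d9]
  have hn' : (3 : ℝ) ≤ n := by exact_mod_cast hn
  have hlogn : 0 ≤ Real.log n := Real.log_nonneg (by linarith)
  have hy : 1 ≤ Real.logb 2 n := by
    rw [Real.logb, one_le_div hl2]
    exact Real.log_le_log (by norm_num) (by linarith)
  have hL := half_le_logb_logb hn
  set L := Real.logb 2 (Real.logb 2 n) with hLdef
  set t := (4 * ε) ^ (1 / 8 : ℝ) with ht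
  rcases le_or_gt (1 / 2) t with ht2 | ht2
  -- For `t ≥ 1 / 2` the leading coefficient is nonpositive and the claim is trivial; otherwise `4 ε
  -- ≤ t`, and the linear error is dominated by `2 t`.
  · nlinarith
  have hεt : 4 * ε ≤ t :=
    le_rpow_of_le_one (by linarith) (by norm_num) (by norm_num) (by rw [← ht]; linarith)
  have hH := one_le_harmonicSum (n := n) (by omega)
  have hHn : Real.log n ≤ harmonicSum n :=
    (Real.log_le_log (by linarith) (by linarith)).trans (log_add_one_le_harmonicSum n)
  have h1 : (1 - 2 * t) * Real.log n ≤ (1 - 2 * ε) * harmonicSum n :=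
    mul_le_mul (by linarith) hHn hlogn (by linarith)
  have hlogy : Real.log n = Real.log 2 * Real.logb 2 n := log_eq_mul_logb _
  have h2 : Real.log (harmonicSum n) ≤ 1 + L := by
    have h3 : harmonicSum n ≤ 2 * Real.logb 2 n := by
      have := harmonicSum_le n
      nlinarith
    have h4 := Real.log_le_log (by linarith) h3
    rw [Real.log_mul two_ne_zero (by linarith)] at h4
    have h5 : Real.log (Real.logb 2 n) = Real.log 2 * L := log_eq_mul_logb _
    nlinarith
  -- Here `5 + 4 (1 + L) = 9 + 4 L ≤ 22 L`, because `L ≥ 1 / 2`; dividing by `log 2 ≥ 1 / 2` then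
  -- gives `44`.
  have h3 : (1 - 2 * t) * Real.log n ≤ 22 * L + Real.log 2 * C := by linarith
  have h4 : 22 * L ≤ Real.log 2 * (44 * L) := by nlinarith
  have h5 : Real.log 2 * ((1 - 2 * t) * Real.logb 2 n - 44 * L) ≤ Real.log 2 * C := by
    rw [hlogy] at h3
    nlinarith
  exact le_of_mul_le_mul_left h5 hl2

theorem eventually_mul_logb_logb_le (K : ℝ) {η : ℝ} (hη : 0 < η) :
    ∃ N : ℕ, ∀ n : ℕ, N ≤ n → K * Real.logb 2 (Real.logb 2 n) ≤ η * Real.logb 2 n := by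
  have h1 : Filter.Tendsto (fun n : ℕ => Real.logb 2 n) Filter.atTop Filter.atTop :=
    (Real.tendsto_logb_atTop one_lt_two).comp tendsto_natCast_atTop_atTop
  have h2 : (fun y : ℝ => K * Real.logb 2 y) =o[Filter.atTop] fun y : ℝ => y := by
    have : (fun y : ℝ => K * Real.logb 2 y) = fun y => (K / Real.log 2) * Real.log y := by
      ext y
      rw [Real.logb]
      ring
    rw [this]
    exact Real.isLittleO_log_id_atTop.const_mul_left _
  have h3 := (h1.eventually ((h2.bound hη).and (Filter.eventually_ge_atTop 0)))
  obtain ⟨N, hN⟩ := Filter.eventually_atTop.1 h3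
  refine ⟨N, fun n hn => ?_⟩
  obtain ⟨h4, h5⟩ := hN n hn
  rw [Real.norm_of_nonneg h5] at h4
  exact (le_abs_self _).trans h4

/-! ### A protocol with one message -/

/-- The matrix of the map of basis vectors `|j⟩ ↦ |f j⟩`. -/
def basisMap {α β : Type} [DecidableEq α] (f : β → α) : Matrix α β ℂ :=
  Matrix.of fun y j => if y = f j then 1 else 0

theorem basisMap_isometry {α β : Type} [Fintype α] [DecidableEq α] [DecidableEq β] {f : β → α}
    (hf : Function.Injective f) : (basisMap f)ᴴ * basisMap f = 1 := by
  ext i j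
  simp [basisMap, Matrix.mul_apply, Matrix.one_apply, hf.eq_iff, apply_ite, eq_comm]

section OneMessage

variable {n D : ℕ}

/-- Division with remainder by `n`, on the basis vectors of Bob's system. -/
def splitIndex (hn : 1 ≤ n) (t : Fin D) : Fin n × Fin D :=
  (⟨t % n, Nat.mod_lt _ hn⟩, ⟨t / n, (Nat.div_le_self _ _).trans_lt t.isLt⟩)

theorem splitIndex_injective (hn : 1 ≤ n) : Function.Injective (splitIndex (D := D) hn) := by
  intro s t hst
  simp only [splitIndex, Prod.mk.injEq, Fin.mk.injEq] at hst
  refine Fin.ext ?_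
  rw [← Nat.div_add_mod (s : ℕ) n, ← Nat.div_add_mod (t : ℕ) n, hst.1, hst.2]

variable [NeZero D]

/-- Alice's measurement operator: a cyclic shift by `x`, followed by filtering with the Schmidt
coefficients of `|μ(n)⟩`. -/
noncomputable def shiftFilter (h : n ≤ D) (x : Fin D) : Matrix (Fin n) (Fin D) ℂ :=
  Matrix.of fun i j => if j - x = Fin.castLE h i then (amplitude n i : ℂ) else 0

/-- For given `i` and `j` exactly one shift `x` fits, so each diagonal entry is the sum of the
squared amplitudes; `i` and `x` determine `j`, so the others vanish. -/
theorem sum_shiftFilter (hn : 1 ≤ n) (h : n ≤ D) :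
    ∑ x, (shiftFilter h x)ᴴ * shiftFilter h x = 1 := by
  ext j j'
  rw [Matrix.sum_apply]
  simp only [Matrix.mul_apply, Matrix.conjTranspose_apply, shiftFilter, Matrix.of_apply]
  rw [Finset.sum_comm]
  by_cases hj : j = j'
  · subst hj
    have h1 : ∀ i : Fin n, (∑ x : Fin D,
        star (if j - x = Fin.castLE h i then (amplitude n i : ℂ) else 0) *
          (if j - x = Fin.castLE h i then (amplitude n i : ℂ) else 0)) =
        ((amplitude n i ^ 2 : ℝ) : ℂ) := by
      intro i
      rw [Finset.sum_eq_single (j - Fin.castLE h i)]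
      · simp [sq]
      · intro x _ hx
        rw [if_neg, mul_zero]
        intro hc
        exact hx (by rw [← hc]; abel)
      · simp
    rw [Finset.sum_congr rfl fun i _ => h1 i, Matrix.one_apply_eq, ← Complex.ofReal_sum,
      sum_amplitude_sq hn, Complex.ofReal_one]
  · rw [Matrix.one_apply_ne hj]
    refine Finset.sum_eq_zero fun i _ => Finset.sum_eq_zero fun x _ => ?_
    by_cases h1 : j - x = Fin.castLE h i
    · rw [if_neg (c := j' - x = Fin.castLE h i), mul_zero]
      intro h2
      exact hj (sub_left_injective (h1.trans h2.symm))
    · rw [if_neg h1, star_zero, zero_mul]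

/-- After the shift is undone Bob's index is below `n`, so his discarded register is left in the
state `|0⟩` and tracing it out does no harm. -/
theorem splitIndex_castLE (hn : 1 ≤ n) (h : n ≤ D) (i : Fin n) :
    splitIndex hn (Fin.castLE h i) = (i, 0) := by
  refine Prod.ext (Fin.ext ?_) (Fin.ext ?_)
  · simp [splitIndex, Nat.mod_eq_of_lt i.isLt]
  · simp [splitIndex, Nat.div_eq_of_lt i.isLt]

theorem discard_shiftFilter (hn : 1 ≤ n) (h : n ≤ D) (x : Fin D) (c : ℝ) :
    discard (basisMap (fun i : Fin n => (i, (0 : Fin 1))) *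
      (shiftFilter h x * ((c : ℂ) • (1 : Matrix (Fin D) (Fin D) ℂ))) *
      (basisMap fun j => splitIndex hn (j - x))ᵀ) =
    ((c ^ 2 : ℝ) : ℂ) • density (embezzlingState n) := by
  have hψ : basisMap (fun i : Fin n => (i, (0 : Fin 1))) *
      (shiftFilter h x * ((c : ℂ) • (1 : Matrix (Fin D) (Fin D) ℂ))) *
      (basisMap fun j => splitIndex hn (j - x))ᵀ =
      Matrix.of fun y z => if z = (y.1, 0) then (c : ℂ) * amplitude n y.1 else 0 := by
    ext ⟨i, k⟩ z
    rw [Matrix.mul_smul, Matrix.mul_one, Matrix.mul_smul, Matrix.smul_mul, Matrix.smul_apply,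
      Matrix.mul_apply]
    have h1 : ∀ j, (basisMap (fun i : Fin n => (i, (0 : Fin 1))) * shiftFilter h x) (i, k) j =
        shiftFilter h x i j := by
      intro j
      rw [Matrix.mul_apply, Finset.sum_eq_single i]
      · simp [basisMap, Subsingleton.elim k 0]
      · intro i' _ hi'
        simp [basisMap, hi'.symm]
      · simp
    simp only [h1]
    -- The filter leaves Alice's `|i⟩` paired with Bob's `|i + x⟩` only.
    rw [Finset.sum_eq_single (Fin.castLE h i + x)]
    · simp [shiftFilter, basisMap, splitIndex_castLE]
    · intro j _ hj
      rw [shiftFilter, Matrix.of_apply, if_neg, zero_mul]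
      intro hc
      exact hj (by rw [← hc]; abel)
    · simp
  rw [hψ]
  ext y z
  simp only [discard, Matrix.of_apply, density, Matrix.smul_apply, embezzlingState]
  by_cases h1 : y.2 = y.1
  · by_cases h2 : z.2 = z.1
    · simp [h1, h2, amplitude]
      ring
    · simp [h1, h2, Ne.symm h2]
  · simp [h1, Ne.symm h1]

/-- Alice measures and announces the outcome; Bob undoes the shift. -/
noncomputable def dilutionProtocol (hn : 1 ≤ n) (h : n ≤ D) : ClassicalProtocol n D D :=
  .alice D (shiftFilter h) (sum_shiftFilter hn h) fun x =>
    .finish (basisMap fun i : Fin n => (i, (0 : Fin 1)))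
      (basisMap_isometry fun _ _ hij => (Prod.mk.inj hij).1)
      (basisMap fun j => splitIndex hn (j - x))
      (basisMap_isometry ((splitIndex_injective hn).comp (sub_left_injective (b := x))))

theorem dilutionProtocol_cost (hn : 1 ≤ n) (h : n ≤ D) :
    (dilutionProtocol hn h).cost = Real.logb 2 D := by
  simp [dilutionProtocol, ClassicalProtocol.cost]

end OneMessage

theorem dilutionProtocol_output {n m : ℕ} (hn : 1 ≤ n) (h : n ≤ 2 ^ m) :
    (dilutionProtocol hn h).output (eprPairs m) = density (embezzlingState n) := by
  simp only [dilutionProtocol, ClassicalProtocol.output]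
  rw [eprPairs_eq_smul_one]
  simp only [discard_shiftFilter]
  rw [Finset.sum_const, Finset.card_univ, Fintype.card_fin, epr_amplitude_sq,
    ← Nat.cast_smul_eq_nsmul ℂ, smul_smul]
  have : ((2 ^ m : ℕ) : ℂ) * (((1 / 2 : ℝ) ^ m : ℝ) : ℂ) = 1 := by
    push_cast
    rw [← mul_pow]
    norm_num
  rw [this, one_smul]

theorem fidelity_density_self {n : ℕ} (hn : 1 ≤ n) :
    fidelity (density (embezzlingState n)) (density (embezzlingState n)) = 1 := by
  have hf := frobSq_embezzlingState hn
  rw [fidelity_density hf (posSemidef_density _), overlap_density, star_vec_dotProduct_vec, hf]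
  simp

end EntanglementCost

/-! ### The theorem -/

theorem mainTheorem6 :
    -- the spectral bound
    (∀ n : ℕ, 1 ≤ n → ∀ δ : ℝ, 0 ≤ δ → δ < 1 →
      (1 - 2 * δ) * Real.logb 2 n - 4 - Real.logb 2 (Real.logb 2 ((n : ℝ) + 1)) ≤
        EntanglementCost.robustDelta
          (EntanglementCost.traceBob_density_isHermitian (EntanglementCost.embezzlingState n)) δ) ∧
    -- lower bound on quantum communication
    (∃ K : ℝ, ∀ n : ℕ, 3 ≤ n → ∀ ε : ℝ, 0 ≤ ε → ∀ m : ℕ,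
      ∀ P : EntanglementCost.QuantumProtocol n (2 ^ m) (2 ^ m),
        1 - ε ≤ EntanglementCost.fidelity
          (EntanglementCost.density (EntanglementCost.embezzlingState n))
          (P.output (EntanglementCost.eprPairs m)) →
        (1 / 2 - (4 * ε) ^ (1 / 8 : ℝ)) * Real.logb 2 n - K * Real.logb 2 (Real.logb 2 n) ≤
          P.cost) ∧
    -- lower bounds on classical communication
    (∃ K : ℝ, ∀ n : ℕ, 3 ≤ n → ∀ ε : ℝ, 0 ≤ ε → ∀ m : ℕ,
      ∀ P : EntanglementCost.ClassicalProtocol n (2 ^ m) (2 ^ m),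
        1 - ε ≤ EntanglementCost.fidelity
          (EntanglementCost.density (EntanglementCost.embezzlingState n))
          (P.output (EntanglementCost.eprPairs m)) →
        (1 - 2 * (4 * ε) ^ (1 / 8 : ℝ)) * Real.logb 2 n - K * Real.logb 2 (Real.logb 2 n) ≤
          P.cost) ∧
    (∀ η : ℝ, 0 < η → ∃ ε₀ : ℝ, 0 < ε₀ ∧ ∃ N : ℕ, ∀ n : ℕ, N ≤ n → ∀ m : ℕ,
      ∀ P : EntanglementCost.ClassicalProtocol n (2 ^ m) (2 ^ m),
        1 - ε₀ ≤ EntanglementCost.fidelity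
          (EntanglementCost.density (EntanglementCost.embezzlingState n))
          (P.output (EntanglementCost.eprPairs m)) →
        (1 - η) * Real.logb 2 n ≤ P.cost) ∧
    -- the matching upper bound on classical communication
    (∀ n : ℕ, 1 ≤ n →
      ∃ P : EntanglementCost.ClassicalProtocol n (2 ^ ⌈Real.logb 2 n⌉₊) (2 ^ ⌈Real.logb 2 n⌉₊),
        EntanglementCost.fidelity
          (EntanglementCost.density (EntanglementCost.embezzlingState n))
          (P.output (EntanglementCost.eprPairs ⌈Real.logb 2 n⌉₊)) = 1 ∧
        P.cost ≤ (⌈Real.logb 2 n⌉₊ : ℝ)) := by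
  refine ⟨fun n hn δ hδ hδ1 => EntanglementCost.robustDelta_embezzlingState_ge hn hδ hδ1,
    ⟨22, fun n hn ε hε m P h => ?_⟩, ⟨44, fun n hn ε hε m P h => ?_⟩, fun η hη => ?_,
    fun n hn => ?_⟩
  -- Twice the number of qubits plays the role of the number of bits, so everything is halved,
  -- including `44`.
  · have := EntanglementCost.cost_ge_of_harmonic_bound hn hε
      (mul_nonneg zero_le_two P.cost_nonneg) (P.cost_bound (by omega) h)
    linarith
  · exact EntanglementCost.cost_ge_of_harmonic_bound hn hε P.cost_nonneg
      (P.cost_bound (by omega) h)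
  · obtain ⟨N, hN⟩ := EntanglementCost.eventually_mul_logb_logb_le 44 (half_pos hη)
    -- This `ε₀` makes the eighth root equal to `η / 4`, so the fidelity error takes `η / 2` and the
    -- double logarithm the other half.
    refine ⟨(η / 4) ^ 8 / 4, by positivity, max N 3, fun n hn m P h => ?_⟩
    have h1 := EntanglementCost.cost_ge_of_harmonic_bound (le_of_max_le_right hn) (by positivity)
      P.cost_nonneg (P.cost_bound (by omega) h)
    have h2 := hN n (le_of_max_le_left hn)
    have h3 : (4 * ((η / 4) ^ 8 / 4)) ^ (1 / 8 : ℝ) = η / 4 := by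
      rw [mul_div_cancel₀ _ (four_ne_zero), ← Real.rpow_natCast, ← Real.rpow_mul (by positivity)]
      norm_num
    rw [h3] at h1
    linarith
  · have hD : n ≤ 2 ^ ⌈Real.logb 2 n⌉₊ := by
      have h1 : (n : ℝ) ≤ 2 ^ (⌈Real.logb 2 n⌉₊ : ℝ) := by
        rw [← Real.logb_le_iff_le_rpow one_lt_two (by exact_mod_cast hn)]
        exact Nat.le_ceil _
      rw [Real.rpow_natCast] at h1
      exact_mod_cast h1
    refine ⟨EntanglementCost.dilutionProtocol hn hD, ?_, ?_⟩
    · rw [EntanglementCost.dilutionProtocol_output, EntanglementCost.fidelity_density_self hn]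
    · rw [EntanglementCost.dilutionProtocol_cost]
      push_cast
      rw [Real.logb_pow, Real.logb_self_eq_one one_lt_two, mul_one]
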